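/- Let $N\ge 2$ be an integer and let $B,L\subset\mathbb Z$ be finite sets with $\#B=\#L\ge 2$, $0\in B\cap L$ and $\#B<N$, such that $(N,B,L)$ is a Hadamard triple, i.e. the matrix $\big(\tfrac{1}{\sqrt{\#B}}e^{2\pi i b\ell/N}\big)_{b\in B,\,\ell\in L}$ is unitary. Write $\tau_a(x)=(x+a)/N$. Let $\mu_{N,B}$ be the self-similar measure, i.e. the unique Borel probability measure on $\mathbb R$ with $\mu=\frac1{\#B}\sum_{b\in B}\mu\circ\tau_b^{-1}$. A finite set $C=\{x_1,\dots,x_r\}\subset\mathbb R$ with $r\ge1$ is an $m_B$-cycle if there are $\ell_1,\dots,\ell_r\in L$ with $\tau_{\ell_j}(x_j)=x_{j+1}$ for $1\le j<r$ and $\tau_{\ell_r}(x_r)=x_1$, and $\big|\frac1{\#B}\sum_{b\in B}e^{2\pi i b x_j}\big|=1$ for all $j$. Let $\Lambda\subset\mathbb R$ be the smallest set that contains $-C$ for every $m_B$-cycle $C$ and satisfies $N\Lambda+L\subset\Lambda$; $(\mu_{N,B},\Lambda)$ is the canonical spectral pair generated by $(N,B,L)$. A real number $t$ is a spectral eigenvalue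 of $(\mu_{N,B},\Lambda)$ if $(\mu_{N,B},t\Lambda)$ is a spectral pair, i.e. $t\Lambda$ is countable and $\{e^{2\pi i\lambda x}:\lambda\in t\Lambda\}$ is an orthonormal basis of $L^2(\mu_{N,B})$. Let $p_1,\dots,p_k$ be distinct primes with $\gcd(p_1p_2\cdots p_k,N)=1$. Then there is an integer $n_0\ge 0$, depending only on $(N,B,L)$ and $p_1,\dots,p_k$, such that for every integer $n\ge n_0$: if $(p_1p_2\cdots p_k)^{n}$ is a spectral eigenvalue of $(\mu_{N,B},\Lambda)$, then $p_1^{n_1}p_2^{n_2}\cdots p_k^{n_k}$ is a spectral eigenvalue of $(\mu_{N,B},\Lambda)$ for all non-negative integers $n_1,\dots,n_k$. -/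

import Mathlib

open MeasureTheory
open scoped Pointwise ENNReal

noncomputable section

namespace CanonicalSpectrum

/-! ### Hadamard triples -/

/-- The matrix `(#B)^{-1/2} e^{2πi bℓ/N}` with rows `b ∈ B` and columns `ℓ ∈ L`. -/
def hadamardMatrix (N : ℕ) (B L : Finset ℤ) : Matrix B L ℂ :=
  Matrix.of fun b l =>
    (1 / (Real.sqrt (B.card : ℝ) : ℂ)) *
      Complex.exp (2 * Real.pi * Complex.I * (((b : ℤ) : ℂ) * ((l : ℤ) : ℂ) / (N : ℂ)))

/-- `(N, B, L)` is a Hadamard triple in `ℝ`. Rows and columns of the matrix are indexed by different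
types, so unitarity is stated as two-sided invertibility by the conjugate transpose. -/
structure IsHadamardTriple (N : ℕ) (B L : Finset ℤ) : Prop where
  two_le : 2 ≤ N
  card_eq : B.card = L.card
  two_le_card : 2 ≤ B.card
  mul_conjTranspose : hadamardMatrix N B L * (hadamardMatrix N B L).conjTranspose = 1
  conjTranspose_mul : (hadamardMatrix N B L).conjTranspose * hadamardMatrix N B L = 1

/-- The digit set `B` of a Hadamard triple is not empty. -/
theorem IsHadamardTriple.nonempty {N : ℕ} {B L : Finset ℤ} (h : IsHadamardTriple N B L) :
    B.Nonempty :=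
  Finset.card_pos.1 (lt_of_lt_of_le Nat.zero_lt_two h.two_le_card)

/-! ### The self-similar measure -/

/-- The contraction `τ_a(x) = (x + a) / N`. -/
def tau (N : ℕ) (a : ℤ) (x : ℝ) : ℝ := (x + (a : ℝ)) / (N : ℝ)

/-- `μ` is a Borel probability measure with `μ = (1/#B) ∑_{b ∈ B} μ ∘ τ_b⁻¹`. -/
structure IsSelfSimilarMeasure (N : ℕ) (B : Finset ℤ) (μ : Measure ℝ) : Prop where
  isProbabilityMeasure : IsProbabilityMeasure μ
  eq_sum : μ = (B.card : ℝ≥0∞)⁻¹ • ∑ b ∈ B, μ.map (tau N b)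

/-- The uniform probability measure on the digit set `B`. -/
def digitMeasure (B : Finset ℤ) (hB : B.Nonempty) : Measure B :=
  haveI : Nonempty B := hB.to_subtype
  (PMF.uniformOfFintype B).toMeasure

/-- The uniform measure on the digits is a probability measure. -/
instance digitMeasure_isProbabilityMeasure (B : Finset ℤ) (hB : B.Nonempty) :
    IsProbabilityMeasure (digitMeasure B hB) := by
  unfold digitMeasure
  infer_instance

/-- The point `∑_{k ≥ 1} b_k N^{-k}` with digit sequence `(b_k)` in `B`. -/
def digitSeries (N : ℕ) (B : Finset ℤ) (w : ℕ → B) : ℝ :=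
  ∑' k : ℕ, (((w k : ℤ) : ℝ)) / (N : ℝ) ^ (k + 1)

/-- The self-similar measure `μ_{N,B}`, built as the law of `∑_{k ≥ 1} b_k N^{-k}` with independent
digits `b_k` that are uniform on `B`. For `N ≥ 2` it is the unique measure satisfying
`IsSelfSimilarMeasure N B`: see `isSelfSimilarMeasure_selfSimilarMeasure` and
`IsSelfSimilarMeasure.unique`. -/
def selfSimilarMeasure (N : ℕ) (B : Finset ℤ) (hB : B.Nonempty) : Measure ℝ :=
  (Measure.infinitePi fun _ : ℕ => digitMeasure B hB).map (digitSeries N B)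

theorem summable_digitSeries {N : ℕ} (hN : 2 ≤ N) (B : Finset ℤ) (w : ℕ → B) :
    Summable fun k : ℕ => (((w k : ℤ) : ℝ)) / (N : ℝ) ^ (k + 1) := by
  have hN1 : (1 : ℝ) < N := by exact_mod_cast (by omega : 1 < N)
  have hN0 : (0 : ℝ) < N := by linarith
  obtain ⟨M, hM⟩ : ∃ M : ℝ, ∀ b ∈ B, |((b : ℤ) : ℝ)| ≤ M := by
    refine ⟨∑ b ∈ B, |((b : ℤ) : ℝ)|, fun b hb => ?_⟩
    exact Finset.single_le_sum (f := fun b : ℤ => |(b : ℝ)|) (fun _ _ => abs_nonneg _) hb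
  have hg : Summable fun k : ℕ => M * ((N : ℝ)⁻¹) ^ (k + 1) := by
    refine Summable.mul_left M ?_
    exact (summable_nat_add_iff 1).2
      (summable_geometric_of_lt_one (by positivity) (inv_lt_one_of_one_lt₀ hN1))
  refine Summable.of_norm_bounded hg fun k => ?_
  rw [norm_div, norm_pow, Real.norm_eq_abs, Real.norm_eq_abs, abs_of_pos hN0, inv_pow,
    div_eq_mul_inv]
  exact mul_le_mul_of_nonneg_right (hM _ (w k).2) (by positivity)

theorem measurable_digitSeries (N : ℕ) (B : Finset ℤ) : Measurable (digitSeries N B) := by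
  unfold digitSeries
  have h (k : ℕ) : Measurable fun w : ℕ → B => (((w k : ℤ) : ℝ)) / (N : ℝ) ^ (k + 1) :=
    ((measurable_of_countable fun b : B => ((b : ℤ) : ℝ)).comp (measurable_pi_apply k)).div_const _
  exact Measurable.tsum h

theorem measurable_tau (N : ℕ) (a : ℤ) : Measurable (tau N a) := by
  unfold tau
  fun_prop

instance selfSimilarMeasure_isProbabilityMeasure (N : ℕ) (B : Finset ℤ) (hB : B.Nonempty) :
    IsProbabilityMeasure (selfSimilarMeasure N B hB) :=
  Measure.isProbabilityMeasure_map (measurable_digitSeries N B).aemeasurable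

theorem digitSeries_cons {N : ℕ} (hN : 2 ≤ N) (B : Finset ℤ) (b : B) (w : ℕ → B) :
    digitSeries N B (fun n => Nat.casesOn n b w) = tau N b (digitSeries N B w) := by
  have hN0 : (N : ℝ) ≠ 0 := by
    have : N ≠ 0 := by omega
    exact_mod_cast this
  unfold digitSeries tau
  rw [(summable_digitSeries hN B _).tsum_eq_zero_add, add_div, ← tsum_div_const, add_comm]
  congr 1
  · refine tsum_congr fun k => ?_
    show ((w k : ℤ) : ℝ) / _ = _
    rw [div_div, ← pow_succ]
  · simp

theorem infinitePi_map_cons {X : Type*} [MeasurableSpace X] (ν : Measure X)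
    [IsProbabilityMeasure ν] :
    (ν.prod (Measure.infinitePi fun _ : ℕ => ν)).map
      (fun q : X × (ℕ → X) => (fun n => Nat.casesOn n q.1 q.2 : ℕ → X)) =
      Measure.infinitePi fun _ : ℕ => ν := by
  classical
  have hm : Measurable (fun q : X × (ℕ → X) => (fun n => Nat.casesOn n q.1 q.2 : ℕ → X)) := by
    refine measurable_pi_lambda _ fun n => ?_
    cases n with
    | zero => exact measurable_fst
    | succ n => exact (measurable_pi_apply n).comp measurable_snd
  refine Measure.eq_infinitePi _ fun s t ht => ?_
  obtain ⟨m, hsm⟩ : ∃ m, s ⊆ Finset.range (m + 1) :=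
    ⟨s.sup id, fun i hi => Finset.mem_range.2 (Nat.lt_succ_of_le (Finset.le_sup (f := id) hi))⟩
  set t' : ℕ → Set X := fun i => if i ∈ s then t i else Set.univ with ht'
  have ht'm (i : ℕ) : MeasurableSet (t' i) := by
    by_cases hi : i ∈ s <;> simp [t', hi, ht]
  have hset : (s : Set ℕ).pi t = (Finset.range (m + 1) : Set ℕ).pi t' := by
    ext f
    simp only [Set.mem_pi, Finset.mem_coe]
    constructor
    · intro h i _
      by_cases hi : i ∈ s
      · simpa [t', hi] using h i hi
      · simp [t', hi]
    · intro h i hi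
      simpa [t', hi] using h i (hsm hi)
  have hprod : ∏ i ∈ s, ν (t i) = ∏ i ∈ Finset.range (m + 1), ν (t' i) := by
    rw [← Finset.prod_subset hsm]
    · exact Finset.prod_congr rfl fun i hi => by simp [t', hi]
    · intro i _ hi
      simp [t', hi]
  have hpre : (fun q : X × (ℕ → X) => (fun n => Nat.casesOn n q.1 q.2 : ℕ → X)) ⁻¹'
      ((Finset.range (m + 1) : Set ℕ).pi t') =
      t' 0 ×ˢ ((Finset.range m : Set ℕ).pi fun i => t' (i + 1)) := by
    ext ⟨x, w⟩
    simp only [Set.mem_preimage, Set.mem_pi, Finset.mem_coe, Finset.mem_range, Set.mem_prod]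
    constructor
    · exact fun h => ⟨h 0 (by omega), fun i hi => h (i + 1) (by omega)⟩
    · rintro ⟨h0, h1⟩ i hi
      cases i with
      | zero => exact h0
      | succ i => exact h1 i (by omega)
  have hbox : MeasurableSet ((Finset.range (m + 1) : Set ℕ).pi t') :=
    MeasurableSet.pi (Finset.countable_toSet _) fun i _ => ht'm i
  rw [hset, hprod, Measure.map_apply hm hbox, hpre, Measure.prod_prod, Measure.infinitePi_pi _
    (fun i _ => ht'm (i + 1)), Finset.prod_range_succ', mul_comm]

/-- The law of the random digit series solves the self-similarity equation. -/
theorem isSelfSimilarMeasure_selfSimilarMeasure {N : ℕ} (hN : 2 ≤ N) (B : Finset ℤ)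
    (hB : B.Nonempty) : IsSelfSimilarMeasure N B (selfSimilarMeasure N B hB) := by
  refine ⟨inferInstance, ?_⟩
  have : Nonempty B := hB.to_subtype
  have hX := measurable_digitSeries N B
  ext s hs
  have hm : Measurable (fun q : B × (ℕ → B) => (fun n => Nat.casesOn n q.1 q.2 : ℕ → B)) := by
    refine measurable_pi_lambda _ fun n => ?_
    cases n with
    | zero => exact measurable_fst
    | succ n => exact (measurable_pi_apply n).comp measurable_snd
  have h1 : selfSimilarMeasure N B hB s = ∑ b : B, (B.card : ℝ≥0∞)⁻¹ *
      (selfSimilarMeasure N B hB) (tau N b ⁻¹' s) := by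
    conv_lhs => rw [selfSimilarMeasure, ← infinitePi_map_cons (digitMeasure B hB)]
    rw [Measure.map_map hX hm, Measure.map_apply (hX.comp hm) hs,
      Measure.prod_apply ((hX.comp hm) hs), lintegral_fintype]
    refine Finset.sum_congr rfl fun b _ => ?_
    rw [mul_comm]
    congr 1
    · simp [digitMeasure]
    · rw [selfSimilarMeasure, Measure.map_apply hX (measurable_tau N b hs)]
      congr 1
      ext w
      simp only [Set.mem_preimage, Function.comp_apply]
      rw [digitSeries_cons hN]
  rw [h1, Measure.smul_apply, Measure.finsetSum_apply, smul_eq_mul, Finset.mul_sum,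
    ← Finset.sum_coe_sort B]
  refine Finset.sum_congr rfl fun b _ => ?_
  rw [Measure.map_apply (measurable_tau N b) hs]

/-- The self-similarity equation has at most one solution. -/
theorem IsSelfSimilarMeasure.unique {N : ℕ} (hN : 2 ≤ N) {B : Finset ℤ} (hB : B.Nonempty)
    {μ ν : Measure ℝ} (hμ : IsSelfSimilarMeasure N B μ) (hν : IsSelfSimilarMeasure N B ν) :
    μ = ν := by
  have := hμ.isProbabilityMeasure
  have := hν.isProbabilityMeasure
  have key (ρ : Measure ℝ) (hρ : IsSelfSimilarMeasure N B ρ) (t : ℝ) :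
      charFun ρ t = ((B.card : ℂ)⁻¹ * ∑ b ∈ B, Complex.exp (t * (b / N) * Complex.I)) *
        charFun ρ (t / N) := by
    have := hρ.isProbabilityMeasure
    have hint (b : ℤ) : Integrable (fun x : ℝ => Complex.exp (t * x * Complex.I))
        (ρ.map (tau N b)) := by
      have := Measure.isProbabilityMeasure_map (μ := ρ) (measurable_tau N b).aemeasurable
      refine Integrable.of_bound (C := 1) (by fun_prop) (Filter.Eventually.of_forall fun x => ?_)
      rw [← Complex.ofReal_mul, Complex.norm_exp_ofReal_mul_I]
    conv_lhs => rw [hρ.eq_sum]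
    rw [charFun_apply_real, integral_smul_measure, integral_finsetSum_measure fun b _ => hint b]
    rw [charFun_apply_real, mul_assoc, Finset.sum_mul]
    have hc : ((B.card : ℝ≥0∞)⁻¹).toReal = (B.card : ℝ)⁻¹ := by simp
    rw [hc, Complex.real_smul]
    push_cast
    congr 1
    refine Finset.sum_congr rfl fun b _ => ?_
    rw [integral_map (measurable_tau N b).aemeasurable (by fun_prop), ← integral_const_mul]
    refine integral_congr_ae (Filter.Eventually.of_forall fun x => ?_)
    simp only [tau]
    rw [← Complex.exp_add]
    congr 1
    push_cast
    ring
  have hstep (t : ℝ) : ‖charFun μ t - charFun ν t‖ ≤ ‖charFun μ (t / N) - charFun ν (t / N)‖ := by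
    rw [key μ hμ t, key ν hν t, ← mul_sub, norm_mul]
    refine mul_le_of_le_one_left (norm_nonneg _) ?_
    rw [norm_mul, norm_inv, Complex.norm_natCast]
    have hpos : (0 : ℝ) < B.card := by exact_mod_cast hB.card_pos
    have hs : ‖∑ b ∈ B, Complex.exp ((t : ℂ) * (b / N) * Complex.I)‖ ≤ B.card := by
      refine (norm_sum_le _ _).trans ?_
      have (b : ℤ) : ‖Complex.exp ((t : ℂ) * (b / N) * Complex.I)‖ = 1 := by
        have h := Complex.norm_exp_ofReal_mul_I (t * (b / N))
        push_cast at h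
        exact h
      simp [this]
    calc (B.card : ℝ)⁻¹ * ‖∑ b ∈ B, Complex.exp ((t : ℂ) * (b / N) * Complex.I)‖
        ≤ (B.card : ℝ)⁻¹ * B.card := by gcongr
      _ = 1 := inv_mul_cancel₀ hpos.ne'
  have hiter (t : ℝ) (n : ℕ) : ‖charFun μ t - charFun ν t‖ ≤
      ‖charFun μ (t / N ^ n) - charFun ν (t / N ^ n)‖ := by
    induction n with
    | zero => simp
    | succ n ih =>
      refine ih.trans ((hstep _).trans_eq ?_)
      rw [div_div, ← pow_succ]
  refine Measure.ext_of_charFun (funext fun t => ?_)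
  have hN1 : (1 : ℝ) < N := by exact_mod_cast (by omega : 1 < N)
  have hlim : Filter.Tendsto (fun n : ℕ => t / (N : ℝ) ^ n) Filter.atTop (nhds 0) :=
    Filter.Tendsto.div_atTop tendsto_const_nhds (tendsto_pow_atTop_atTop_of_one_lt hN1)
  have hcont : Continuous fun t : ℝ => ‖charFun μ t - charFun ν t‖ := by fun_prop
  have h0 := (hcont.tendsto 0).comp hlim
  simp only [charFun_zero, probReal_univ, sub_self, norm_zero] at h0
  have := ge_of_tendsto' h0 (hiter t)
  exact sub_eq_zero.1 (norm_le_zero_iff.1 this)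

/-! ### Spectral pairs -/

/-- `(μ, Λ)` is a spectral pair: `Λ` is countable and the exponentials `e_λ(x) = e^{2πiλx}`,
`λ ∈ Λ`, form an orthonormal basis of `L²(μ)`. -/
def IsSpectralPair (μ : Measure ℝ) [IsProbabilityMeasure μ] (Λ : Set ℝ) : Prop :=
  Λ.Countable ∧ ∃ e : HilbertBasis Λ ℂ (Lp ℂ 2 μ), ∀ l : Λ,
    (e l : ℝ → ℂ) =ᵐ[μ] fun x => Complex.exp (2 * Real.pi * Complex.I * ((l : ℝ) * x : ℝ))

/-- `t` is a spectral eigenvalue of `(μ, Λ)`: `(μ, tΛ)` is also a spectral pair. -/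
def IsSpectralEigenvalue (μ : Measure ℝ) [IsProbabilityMeasure μ] (Λ : Set ℝ) (t : ℝ) : Prop :=
  IsSpectralPair μ (t • Λ)

/-! ### The canonical spectrum -/

/-- `m_B(x) = (1/#B) ∑_{b ∈ B} e^{2πibx}`. -/
def maskFunction (B : Finset ℤ) (x : ℝ) : ℂ :=
  (1 / (B.card : ℂ)) * ∑ b ∈ B, Complex.exp (2 * Real.pi * Complex.I * ((b : ℂ) * (x : ℂ)))

/-- `C = {x_0, …, x_k}` is a cycle: `τ_{ℓ_j}(x_j) = x_{j+1}` with `ℓ_j ∈ L`, where the index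
`j + 1` is taken cyclically (addition in `Fin (k + 1)` wraps around). -/
def IsCycle (N : ℕ) (L : Finset ℤ) (C : Set ℝ) : Prop :=
  ∃ (k : ℕ) (x : Fin (k + 1) → ℝ) (l : Fin (k + 1) → ℤ),
    C = Set.range x ∧ ∀ j, l j ∈ L ∧ tau N (l j) (x j) = x (j + 1)

/-- An `m_B`-cycle (extreme cycle). -/
def IsExtremeCycle (N : ℕ) (B L : Finset ℤ) (C : Set ℝ) : Prop :=
  IsCycle N L C ∧ ∀ x ∈ C, ‖maskFunction B x‖ = 1

/-- The smallest set `Λ` that contains `-C` for all `m_B`-cycles `C` and satisfies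
`NΛ + L ⊆ Λ`. -/
def canonicalSpectrum (N : ℕ) (B L : Finset ℤ) : Set ℝ :=
  ⋂₀ {S : Set ℝ | (∀ C, IsExtremeCycle N B L C → -C ⊆ S) ∧
    ∀ x ∈ S, ∀ l ∈ L, (N : ℝ) * x + (l : ℝ) ∈ S}

end CanonicalSpectrum

end

/-!
For `t` coprime to `N`, Galois conjugation of `N`-th roots of unity shows that `(N, B, tL)` is again
a Hadamard triple, so by Dutkay and Jorgensen its canonical spectrum `Λ_t` is a spectrum of `μ`: the
function `x ↦ ∑_{λ ∈ Λ_t} |μ̂(x + λ)|²` is analytic and harmonic for the transfer operator of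
`|m_B|²`, and its minimum over a compact interval is attained on an extreme cycle. As
`tΛ ⊆ Λ_t`, the number `t` is a spectral eigenvalue if and only if `tΛ = Λ_t`, that is, if and only
if every cycle of the maps `τ_ℓ` that `t` maps into the group `B°` of points where `|m_B| = 1` lies
in `B°` already.

It remains to bound the order `q` in `ℝ / B°` of the periodic points for which `q` divides a power
of `P`. Let `r` be the period of such a point, so that `q ∣ N ^ r - 1`; lifting the exponent gives
`q ≤ N ^ (2φ(P)) * r`. On the other hand the points of the cycle have denominator `O(q)`, so they
are determined by `k ≈ log_N q` digits from `L`, and `r ≤ (#L) ^ k`. Since `#L < N` this bounds `k`,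
hence `q`. Beyond that bound, membership in `B°` is detected by `P ^ n`.
-/

noncomputable section

namespace CanonicalSpectrum

open scoped FourierTransform

/-! ### Unit vectors and roots of unity -/

theorem eq_of_norm_sum_eq_card {E ι : Type*} [NormedAddCommGroup E] [NormedSpace ℝ E]
    [StrictConvexSpace ℝ E] {s : Finset ι} {v : ι → E} (hv : ∀ i ∈ s, ‖v i‖ = 1)
    (hsum : ‖∑ i ∈ s, v i‖ = s.card) {i j : ι} (hi : i ∈ s) (hj : j ∈ s) : v i = v j := by
  classical
  rcases eq_or_ne j i with rfl | hji
  · rfl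
  have hj' : j ∈ s.erase i := Finset.mem_erase.2 ⟨hji, hj⟩
  have hcard : (((s.erase i).erase j).card : ℝ) + 2 = s.card := by
    rw [← Finset.card_erase_add_one hi, ← Finset.card_erase_add_one hj']
    push_cast
    ring
  rw [← Finset.add_sum_erase s v hi, ← Finset.add_sum_erase _ v hj', ← add_assoc, ← hcard] at hsum
  have hrest : ‖∑ k ∈ (s.erase i).erase j, v k‖ ≤ ((s.erase i).erase j).card :=
    (norm_sum_le_of_le _ fun k hk =>
      (hv k (Finset.mem_of_mem_erase (Finset.mem_of_mem_erase hk))).le).trans (by simp)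
  refine eq_of_norm_eq_of_norm_add_eq ((hv i hi).trans (hv j hj).symm) (le_antisymm
    (norm_add_le _ _) ?_)
  rw [hv i hi, hv j hj]
  linarith [norm_add_le (v i + v j) (∑ k ∈ (s.erase i).erase j, v k)]

theorem sum_stdAddChar_natCast_mul_eq_zero {ι : Type*} {N t : ℕ} [NeZero N] (ht : t.Coprime N)
    {s : Finset ι} {f : ι → ZMod N} (h : ∑ i ∈ s, ZMod.stdAddChar (f i) = 0) :
    ∑ i ∈ s, ZMod.stdAddChar ((t : ZMod N) * f i) = 0 := by
  set ζ : ℂ := ZMod.stdAddChar (1 : ZMod N)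
  have hζ : IsPrimitiveRoot ζ N := by
    have hroot : ζ = Complex.exp (2 * Real.pi * Complex.I / N) := by
      simpa using ZMod.stdAddChar_coe (N := N) 1
    rw [hroot]
    exact Complex.isPrimitiveRoot_exp N (NeZero.ne N)
  have hpow (a : ZMod N) : ZMod.stdAddChar a = ζ ^ a.val := by
    rw [← AddChar.map_nsmul_eq_pow, nsmul_one, ZMod.natCast_zmod_val]
  have hpow_mul (a : ZMod N) : ZMod.stdAddChar ((t : ZMod N) * a) = (ζ ^ t) ^ a.val := by
    rw [← nsmul_eq_mul, AddChar.map_nsmul_eq_pow, hpow, pow_right_comm]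
  -- `∑ X ^ f i` vanishes at `ζ`, hence at its Galois conjugate `ζ ^ t`.
  let p : Polynomial ℤ := ∑ i ∈ s, Polynomial.X ^ (f i).val
  have haeval (z : ℂ) : Polynomial.aeval z p = ∑ i ∈ s, z ^ (f i).val := by
    simp only [p, map_sum, map_pow, Polynomial.aeval_X]
  have hdvd : minpoly ℤ (ζ ^ t) ∣ p := by
    rw [← hζ.minpoly_eq_pow_coprime ht]
    refine minpoly.isIntegrallyClosed_dvd (hζ.isIntegral (NeZero.pos N)) ?_
    simpa only [haeval, ← hpow] using h
  obtain ⟨r, hr⟩ := hdvd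
  simp only [hpow_mul, ← haeval, hr, map_mul, minpoly.aeval, zero_mul]

theorem fourierChar_eq_exp (x : ℝ) : (𝐞 x : ℂ) = Complex.exp (2 * Real.pi * Complex.I * x) := by
  rw [Real.fourierChar_apply]
  push_cast
  ring_nf

theorem fourierChar_eq_one_iff {x : ℝ} : 𝐞 x = 1 ↔ ∃ n : ℤ, x = n := by
  rw [Real.fourierChar_apply', Circle.exp_eq_one]
  refine exists_congr fun n => ?_
  rw [mul_comm, mul_left_inj' Real.two_pi_pos.ne']

theorem stdAddChar_intCast {N : ℕ} [NeZero N] (m : ℤ) :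
    ZMod.stdAddChar (m : ZMod N) = (𝐞 (m / N : ℝ) : ℂ) := by
  rw [ZMod.stdAddChar_coe, fourierChar_eq_exp]
  push_cast
  ring_nf

theorem star_fourierChar (x : ℝ) : star (𝐞 x : ℂ) = 𝐞 (-x) := by
  rw [AddChar.map_neg_eq_inv, Circle.coe_inv_eq_conj, RCLike.star_def]

/-! ### The mask function and its period group -/

theorem maskFunction_eq (B : Finset ℤ) (x : ℝ) :
    maskFunction B x = (B.card : ℂ)⁻¹ * ∑ b ∈ B, (𝐞 (b * x) : ℂ) := by
  simp [maskFunction, fourierChar_eq_exp]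

/-- The group `B°` of all `x` with `bx ∈ ℤ` for every `b ∈ B`. Its elements are periods of `m_B`
and, when `0 ∈ B`, it consists of the points where `|m_B| = 1`. -/
def periodGroup (B : Finset ℤ) : AddSubgroup ℝ :=
  ⨅ b ∈ B, (AddSubgroup.zmultiples (1 : ℝ)).comap (AddMonoidHom.mulLeft (b : ℝ))

theorem mem_periodGroup {B : Finset ℤ} {x : ℝ} :
    x ∈ periodGroup B ↔ ∀ b ∈ B, ∃ n : ℤ, b * x = n := by
  simp [periodGroup, AddSubgroup.mem_iInf, AddSubgroup.mem_zmultiples_iff, eq_comm]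

theorem intCast_mem_periodGroup (B : Finset ℤ) (n : ℤ) : (n : ℝ) ∈ periodGroup B :=
  mem_periodGroup.2 fun b _ => ⟨b * n, by push_cast; rfl⟩

theorem exists_mul_eq_intCast_of_mem_periodGroup {B : Finset ℤ} (hB : 2 ≤ B.card) :
    ∃ D : ℤ, D ≠ 0 ∧ ∀ x ∈ periodGroup B, ∃ n : ℤ, D * x = n := by
  obtain ⟨b, hb, hb0⟩ := Finset.exists_mem_ne hB 0
  exact ⟨b, hb0, fun x hx => mem_periodGroup.1 hx b hb⟩

theorem maskFunction_add_of_mem {B : Finset ℤ} (x : ℝ) {y : ℝ} (hy : y ∈ periodGroup B) :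
    maskFunction B (x + y) = maskFunction B x := by
  rw [maskFunction_eq, maskFunction_eq]
  congr 1
  refine Finset.sum_congr rfl fun b hb => ?_
  rw [mul_add, AddChar.map_add_eq_mul, fourierChar_eq_one_iff.2 (mem_periodGroup.1 hy b hb),
    mul_one]

theorem maskFunction_zero {B : Finset ℤ} (hB : B.Nonempty) : maskFunction B 0 = 1 := by
  have hcard : (B.card : ℂ) ≠ 0 := by exact_mod_cast hB.card_pos.ne'
  simp [maskFunction_eq, hcard]

theorem maskFunction_of_mem {B : Finset ℤ} (hB : B.Nonempty) {x : ℝ} (hx : x ∈ periodGroup B) :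
    maskFunction B x = 1 := by
  rw [← zero_add x, maskFunction_add_of_mem 0 hx, maskFunction_zero hB]

theorem mem_periodGroup_of_norm_maskFunction {B : Finset ℤ} (h0 : (0 : ℤ) ∈ B) {x : ℝ}
    (hx : ‖maskFunction B x‖ = 1) : x ∈ periodGroup B := by
  refine mem_periodGroup.2 fun b hb => fourierChar_eq_one_iff.1 (Circle.ext ?_)
  have hcard : (B.card : ℝ) ≠ 0 := by exact_mod_cast (Finset.card_pos.2 ⟨0, h0⟩).ne'
  have hsum : ‖∑ b ∈ B, (𝐞 (b * x) : ℂ)‖ = B.card := by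
    rw [maskFunction_eq, norm_mul, norm_inv, Complex.norm_natCast] at hx
    field_simp at hx
    exact hx
  simpa using eq_of_norm_sum_eq_card (fun b _ => Circle.norm_coe _) hsum hb h0

/-! ### Hadamard triples -/

theorem hadamardMatrix_apply (N : ℕ) (B L : Finset ℤ) (b : B) (l : L) :
    hadamardMatrix N B L b l =
      (Real.sqrt B.card : ℂ)⁻¹ * (𝐞 ((b : ℤ) * (l : ℤ) / N : ℝ) : ℂ) := by
  simp [hadamardMatrix, fourierChar_eq_exp]

theorem inv_ofReal_sqrt_natCast_sq (n : ℕ) : ((Real.sqrt n : ℂ)⁻¹) ^ 2 = (n : ℂ)⁻¹ := by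
  rw [inv_pow, ← Complex.ofReal_pow, Real.sq_sqrt n.cast_nonneg, Complex.ofReal_natCast]

theorem conjTranspose_mul_hadamardMatrix_apply (N : ℕ) (B L : Finset ℤ) (l' l : L) :
    ((hadamardMatrix N B L).conjTranspose * hadamardMatrix N B L) l' l =
      maskFunction B (((l : ℤ) - (l' : ℤ)) / N) := by
  rw [maskFunction_eq, ← inv_ofReal_sqrt_natCast_sq, Matrix.mul_apply, Finset.mul_sum,
    ← Finset.sum_coe_sort B]
  refine Finset.sum_congr rfl fun b _ => ?_
  rw [Matrix.conjTranspose_apply, hadamardMatrix_apply, hadamardMatrix_apply, star_mul',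
    star_fourierChar, mul_mul_mul_comm, ← Circle.coe_mul, ← AddChar.map_add_eq_mul, star_inv₀,
    RCLike.star_def, Complex.conj_ofReal, ← sq]
  ring_nf

theorem isHadamardTriple_iff {N : ℕ} {B L : Finset ℤ} :
    IsHadamardTriple N B L ↔ 2 ≤ N ∧ B.card = L.card ∧ 2 ≤ B.card ∧
      ∀ l ∈ L, ∀ l' ∈ L, l ≠ l' → maskFunction B ((l - l') / N) = 0 := by
  constructor
  · intro h
    refine ⟨h.two_le, h.card_eq, h.two_le_card, fun l hl l' hl' hne => ?_⟩
    rw [← conjTranspose_mul_hadamardMatrix_apply N B L ⟨l', hl'⟩ ⟨l, hl⟩, h.conjTranspose_mul]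
    exact Matrix.one_apply_ne (by simpa using hne.symm)
  · rintro ⟨hN, hcard, hB, hmask⟩
    have hunit : (hadamardMatrix N B L).conjTranspose * hadamardMatrix N B L = 1 := by
      ext l' l
      rw [conjTranspose_mul_hadamardMatrix_apply]
      rcases eq_or_ne l' l with rfl | hne
      · rw [sub_self, zero_div, maskFunction_zero (Finset.card_pos.1 (by omega)),
          Matrix.one_apply_eq]
      · rw [Matrix.one_apply_ne hne]
        exact hmask l l.2 l' l'.2 (Subtype.coe_ne_coe.2 hne.symm)
    exact ⟨hN, hcard, hB,
      (Matrix.mul_eq_one_comm_of_card_eq _ _ _ (by simp [hcard])).1 hunit, hunit⟩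

/-- The dilated digit set `tL`, whose canonical spectrum is what `tΛ` is compared with. -/
def dilate (t : ℕ) (L : Finset ℤ) : Finset ℤ := L.image fun l => (t : ℤ) * l

theorem mem_dilate {t : ℕ} {L : Finset ℤ} {m : ℤ} :
    m ∈ dilate t L ↔ ∃ l ∈ L, (t : ℤ) * l = m := by
  simp [dilate]

theorem card_dilate {t : ℕ} (ht : t ≠ 0) (L : Finset ℤ) : (dilate t L).card = L.card :=
  Finset.card_image_of_injective _ (mul_right_injective₀ (Nat.cast_ne_zero.2 ht))

namespace IsHadamardTriple

variable {N : ℕ} {B L : Finset ℤ}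

theorem natCast_pos (h : IsHadamardTriple N B L) : (0 : ℝ) < N :=
  Nat.cast_pos.2 (zero_lt_two.trans_le h.two_le)

theorem natCast_ne_zero (h : IsHadamardTriple N B L) : (N : ℝ) ≠ 0 := h.natCast_pos.ne'

theorem ne_zero_of_coprime (h : IsHadamardTriple N B L) {t : ℕ} (ht : t.Coprime N) : t ≠ 0 := by
  rintro rfl
  have := h.two_le
  rw [Nat.coprime_zero_left] at ht
  omega

theorem maskFunction_sub_div (h : IsHadamardTriple N B L) {l l' : ℤ} (hl : l ∈ L) (hl' : l' ∈ L)
    (hne : l ≠ l') : maskFunction B ((l - l') / N) = 0 :=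
  (isHadamardTriple_iff.1 h).2.2.2 l hl l' hl' hne

protected theorem dilate (h : IsHadamardTriple N B L) {t : ℕ} (ht : t.Coprime N) :
    IsHadamardTriple N B (dilate t L) := by
  have : NeZero N := ⟨by have := h.two_le; omega⟩
  have hcard : (B.card : ℂ)⁻¹ ≠ 0 := inv_ne_zero (by exact_mod_cast h.nonempty.card_pos.ne')
  have hmask (m : ℤ) : maskFunction B (m / N) =
      (B.card : ℂ)⁻¹ * ∑ b ∈ B, ZMod.stdAddChar ((b * m : ℤ) : ZMod N) := by
    simp_rw [maskFunction_eq, stdAddChar_intCast, Int.cast_mul, mul_div_assoc]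
  refine isHadamardTriple_iff.2 ⟨h.two_le, ?_, h.two_le_card, ?_⟩
  · rw [card_dilate (h.ne_zero_of_coprime ht), h.card_eq]
  simp only [mem_dilate]
  rintro _ ⟨l, hl, rfl⟩ _ ⟨l', hl', rfl⟩ hne
  have hzero := h.maskFunction_sub_div hl hl' (by rintro rfl; exact hne rfl)
  rw [← Int.cast_sub, hmask] at hzero ⊢
  refine mul_eq_zero_of_right _ ?_
  rw [← sum_stdAddChar_natCast_mul_eq_zero ht ((mul_eq_zero.1 hzero).resolve_left hcard)]
  refine Finset.sum_congr rfl fun b _ => ?_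
  push_cast
  ring_nf

theorem eq_of_sub_div_mem (h : IsHadamardTriple N B L) {l l' : ℤ} (hl : l ∈ L) (hl' : l' ∈ L)
    (hmem : ((l : ℝ) - l') / N ∈ periodGroup B) : l = l' := by
  by_contra hne
  have hzero := h.maskFunction_sub_div hl hl' hne
  rw [maskFunction_of_mem h.nonempty hmem] at hzero
  exact one_ne_zero hzero

/-- Parseval for the unitary Hadamard matrix, applied to the unit vector with entries
`(#B)^{-1/2} e^{2πi b x / N}`. -/
theorem sum_norm_maskFunction_tau_sq (h : IsHadamardTriple N B L) (x : ℝ) :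
    ∑ l ∈ L, ‖maskFunction B (tau N l x)‖ ^ 2 = 1 := by
  let H := hadamardMatrix N B L
  let v : B → ℂ := fun b => (Real.sqrt B.card : ℂ)⁻¹ * (𝐞 ((b : ℤ) * x / N : ℝ) : ℂ)
  have hvec (l : L) : Matrix.vecMul v H l = maskFunction B (tau N l x) := by
    rw [maskFunction_eq, ← inv_ofReal_sqrt_natCast_sq, ← Finset.sum_coe_sort B, Finset.mul_sum]
    refine Finset.sum_congr rfl fun b _ => ?_
    change v b * hadamardMatrix N B L b l = _
    rw [hadamardMatrix_apply, mul_mul_mul_comm, ← sq, ← Circle.coe_mul,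
      ← AddChar.map_add_eq_mul, tau]
    ring_nf
  have hunit : v ⬝ᵥ star v = 1 := by
    have hterm (b : B) : v b * star v b = (B.card : ℂ)⁻¹ := by
      rw [Pi.star_apply, star_mul', star_inv₀, star_fourierChar, mul_mul_mul_comm,
        ← Circle.coe_mul, ← AddChar.map_add_eq_mul, add_neg_cancel, RCLike.star_def,
        Complex.conj_ofReal, ← sq, inv_ofReal_sqrt_natCast_sq]
      simp
    have hcard : (B.card : ℂ) ≠ 0 := by exact_mod_cast h.nonempty.card_pos.ne'
    simp only [dotProduct, hterm]
    simp [hcard]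
  have hparseval : Matrix.vecMul v H ⬝ᵥ star (Matrix.vecMul v H) = 1 := by
    rw [Matrix.star_vecMul, Matrix.dotProduct_mulVec, Matrix.vecMul_vecMul, h.mul_conjTranspose,
      Matrix.vecMul_one, hunit]
  rw [← Finset.sum_coe_sort L, ← Complex.ofReal_inj, Complex.ofReal_one, ← hparseval]
  simp [dotProduct, hvec, Complex.mul_conj']

end IsHadamardTriple

/-! ### Periodic paths of the dual iterated function system -/

/-- `a` is a `K`-periodic sequence with `a (n + 1) = τ_ℓ (a n)` for some `ℓ ∈ L`: a walk around a
cycle, indexed by `ℕ` rather than by `Fin K`. -/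
structure IsPeriodicPath (N : ℕ) (L : Finset ℤ) (K : ℕ) (a : ℕ → ℝ) : Prop where
  pos : 0 < K
  step : ∀ n, ∃ l ∈ L, tau N l (a n) = a (n + 1)
  periodic : Function.Periodic a K

theorem mul_tau {N : ℕ} (hN : (N : ℝ) ≠ 0) (l : ℤ) (x : ℝ) : N * tau N l x = x + l :=
  mul_div_cancel₀ _ hN

theorem nsmul_mk_tau {N : ℕ} (hN : (N : ℝ) ≠ 0) (B : Finset ℤ) (l : ℤ) (x : ℝ) :
    N • (tau N l x : ℝ ⧸ periodGroup B) = x := by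
  rw [← QuotientAddGroup.mk_nsmul, nsmul_eq_mul, mul_tau hN, QuotientAddGroup.eq]
  exact neg_mem_iff.1 (by simpa using intCast_mem_periodGroup B l)

theorem abs_tau_le {N : ℕ} (hN : 2 ≤ N) {l : ℤ} {x R M : ℝ} (hl : |(l : ℝ)| ≤ R) (hx : |x| ≤ M) :
    |tau N l x| ≤ (M + R) / 2 := by
  have hN' : (2 : ℝ) ≤ N := by exact_mod_cast hN
  rw [tau, abs_div, Nat.abs_cast]
  exact div_le_div₀ (add_nonneg ((abs_nonneg x).trans hx) ((abs_nonneg _).trans hl))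
    ((abs_add_le _ _).trans (add_le_add hx hl)) two_pos hN'

theorem abs_le_sup_natAbs {L : Finset ℤ} {l : ℤ} (hl : l ∈ L) :
    |(l : ℝ)| ≤ (L.sup Int.natAbs : ℕ) := by
  rw [← Int.cast_abs, Int.abs_eq_natAbs, Int.cast_natCast]
  exact_mod_cast Finset.le_sup (f := Int.natAbs) hl

theorem IsCycle.exists_path {N : ℕ} {L : Finset ℤ} {C : Set ℝ} (hC : IsCycle N L C) {x : ℝ}
    (hx : x ∈ C) : ∃ K a, IsPeriodicPath N L K a ∧ a 0 = x ∧ ∀ n, a n ∈ C := by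
  obtain ⟨k, y, l, rfl, hy⟩ := hC
  obtain ⟨j, rfl⟩ := hx
  refine ⟨k + 1, fun n => y (j + n • 1), ⟨k.succ_pos, fun n => ⟨l (j + n • 1), (hy _).1, ?_⟩,
    fun n => ?_⟩, by simp, fun n => ⟨_, rfl⟩⟩
  · rw [(hy _).2, succ_nsmul, add_assoc]
  · have hcard : (k + 1) • (1 : Fin (k + 1)) = 0 := by
      simpa using card_nsmul_eq_zero' (x := (1 : Fin (k + 1)))
    rw [add_nsmul, hcard, add_zero]

namespace IsPeriodicPath

variable {N : ℕ} {L : Finset ℤ} {K : ℕ} {a : ℕ → ℝ}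

theorem isCycle (h : IsPeriodicPath N L K a) : IsCycle N L (Set.range a) := by
  obtain ⟨k, rfl⟩ := Nat.exists_eq_succ_of_ne_zero h.pos.ne'
  choose l hl using h.step
  refine ⟨k, fun j => a j, fun j => l j, ?_, fun j => ⟨(hl j).1, (hl j).2.trans ?_⟩⟩
  · ext x
    constructor
    · rintro ⟨n, rfl⟩
      exact ⟨⟨n % (k + 1), Nat.mod_lt _ k.succ_pos⟩, h.periodic.map_mod_nat n⟩
    · rintro ⟨j, rfl⟩
      exact ⟨j, rfl⟩
  · simp [← h.periodic.map_mod_nat ((j : ℕ) + 1), Fin.val_add]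

theorem pow_nsmul_mk (h : IsPeriodicPath N L K a) (hN : (N : ℝ) ≠ 0) (B : Finset ℤ) (n j : ℕ) :
    N ^ j • (a (n + j) : ℝ ⧸ periodGroup B) = a n := by
  induction j with
  | zero => simp
  | succ j ih =>
    obtain ⟨l, _, hl⟩ := h.step (n + j)
    rw [← add_assoc, ← hl, pow_succ, mul_smul, nsmul_mk_tau hN, ih]

theorem mem_periodGroup (h : IsPeriodicPath N L K a) (hN : (N : ℝ) ≠ 0) {B : Finset ℤ}
    (h0 : a 0 ∈ periodGroup B) (n : ℕ) : a n ∈ periodGroup B := by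
  have hend : a (n + (n * K - n)) = a 0 := by
    rw [Nat.add_sub_cancel' (Nat.le_mul_of_pos_right n h.pos)]
    exact h.periodic.nat_mul_eq n
  rw [← QuotientAddGroup.eq_zero_iff, ← h.pow_nsmul_mk hN B n (n * K - n), hend,
    (QuotientAddGroup.eq_zero_iff _).2 h0, smul_zero]

theorem isExtremeCycle (h : IsPeriodicPath N L K a) (hN : (N : ℝ) ≠ 0) {B : Finset ℤ}
    (hB : B.Nonempty) (h0 : a 0 ∈ periodGroup B) : IsExtremeCycle N B L (Set.range a) := by
  refine ⟨h.isCycle, ?_⟩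
  rintro _ ⟨n, rfl⟩
  rw [maskFunction_of_mem hB (h.mem_periodGroup hN h0 n), norm_one]

theorem abs_le (h : IsPeriodicPath N L K a) (hN : 2 ≤ N) (n : ℕ) :
    |a n| ≤ (L.sup Int.natAbs : ℕ) := by
  obtain ⟨m, -, hmax⟩ := (Finset.range K).exists_max_image (fun i => |a i|)
    ⟨0, Finset.mem_range.2 h.pos⟩
  have hle (i : ℕ) : |a i| ≤ |a m| := by
    rw [← h.periodic.map_mod_nat i]
    exact hmax _ (Finset.mem_range.2 (Nat.mod_lt i h.pos))
  obtain ⟨l, hl, hpred⟩ := h.step (m + K - 1)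
  rw [Nat.sub_add_cancel (h.pos.trans_le (Nat.le_add_left K m)), h.periodic] at hpred
  have := abs_tau_le hN (abs_le_sup_natAbs hl) (hle (m + K - 1))
  rw [hpred] at this
  linarith [hle n]

theorem mul (h : IsPeriodicPath N L K a) (t : ℕ) :
    IsPeriodicPath N (dilate t L) K fun n => t * a n := by
  refine ⟨h.pos, fun n => ?_, fun n => by rw [h.periodic]⟩
  obtain ⟨l, hl, he⟩ := h.step n
  refine ⟨t * l, mem_dilate.2 ⟨l, hl, rfl⟩, ?_⟩
  rw [← he, tau, tau]
  push_cast
  ring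

theorem div {t : ℕ} (ht : t ≠ 0) (h : IsPeriodicPath N (dilate t L) K a) :
    IsPeriodicPath N L K fun n => a n / t := by
  have ht' : (t : ℝ) ≠ 0 := by exact_mod_cast ht
  refine ⟨h.pos, fun n => ?_, fun n => by rw [h.periodic]⟩
  obtain ⟨m, hm, he⟩ := h.step n
  obtain ⟨l, hl, rfl⟩ := mem_dilate.1 hm
  refine ⟨l, hl, ?_⟩
  rw [← he, tau, tau]
  push_cast
  field_simp

end IsPeriodicPath

/-! ### Structure of the canonical spectrum -/

section CanonicalSpectrum

variable {N : ℕ} {B L : Finset ℤ}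

theorem mul_add_mem_canonicalSpectrum {x : ℝ} (hx : x ∈ canonicalSpectrum N B L) {l : ℤ}
    (hl : l ∈ L) : (N : ℝ) * x + l ∈ canonicalSpectrum N B L :=
  Set.mem_sInter.2 fun S hS => hS.2 x (Set.mem_sInter.1 hx S hS) l hl

theorem neg_mem_canonicalSpectrum {C : Set ℝ} (hC : IsExtremeCycle N B L C) {x : ℝ}
    (hx : x ∈ C) : -x ∈ canonicalSpectrum N B L :=
  Set.mem_sInter.2 fun _ hS => hS.1 C hC (Set.neg_mem_neg.2 hx)

theorem canonicalSpectrum_subset {S : Set ℝ}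
    (hcycle : ∀ C, IsExtremeCycle N B L C → ∀ x ∈ C, -x ∈ S)
    (hstep : ∀ x ∈ S, ∀ l ∈ L, (N : ℝ) * x + (l : ℝ) ∈ S) : canonicalSpectrum N B L ⊆ S :=
  Set.sInter_subset_of_mem
    ⟨fun C hC x hx => by simpa only [neg_neg] using hcycle C hC (-x) (Set.mem_neg.1 hx), hstep⟩

theorem canonicalSpectrum_subset_periodGroup (h0 : 0 ∈ B) :
    canonicalSpectrum N B L ⊆ periodGroup B := by
  refine canonicalSpectrum_subset (fun C hC x hx => ?_) fun x hx l _ => ?_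
  · exact neg_mem (mem_periodGroup_of_norm_maskFunction h0 (hC.2 x hx))
  · exact add_mem (by simpa using nsmul_mem hx N) (intCast_mem_periodGroup B l)

theorem countable_canonicalSpectrum (h0 : 0 ∈ B) (hB : 2 ≤ B.card) :
    (canonicalSpectrum N B L).Countable := by
  obtain ⟨D, hD, hint⟩ := exists_mul_eq_intCast_of_mem_periodGroup hB
  refine (Set.countable_range fun n : ℤ => (n : ℝ) / D).mono fun x hx => ?_
  obtain ⟨n, hn⟩ := hint x (canonicalSpectrum_subset_periodGroup h0 hx)
  exact ⟨n, (eq_div_of_mul_eq (Int.cast_ne_zero.2 hD) (by rw [mul_comm, hn])).symm⟩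

end CanonicalSpectrum

namespace IsHadamardTriple

variable {N : ℕ} {B L : Finset ℤ}

theorem neg_mem_canonicalSpectrum_of_path (h : IsHadamardTriple N B L) {K : ℕ} {a : ℕ → ℝ}
    (ha : IsPeriodicPath N L K a) (h0 : a 0 ∈ periodGroup B) :
    -a 0 ∈ canonicalSpectrum N B L :=
  neg_mem_canonicalSpectrum (ha.isExtremeCycle h.natCast_ne_zero h.nonempty h0) ⟨0, rfl⟩

theorem zero_mem_canonicalSpectrum (h : IsHadamardTriple N B L) (h0 : 0 ∈ L) :
    (0 : ℝ) ∈ canonicalSpectrum N B L := by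
  have hfixed : IsPeriodicPath N L 1 fun _ => 0 :=
    ⟨one_pos, fun _ => ⟨0, h0, by simp [tau]⟩, fun _ => rfl⟩
  simpa using h.neg_mem_canonicalSpectrum_of_path hfixed (zero_mem _)

theorem exists_eq_mul_add (h : IsHadamardTriple N B L) {x : ℝ}
    (hx : x ∈ canonicalSpectrum N B L) :
    ∃ y ∈ canonicalSpectrum N B L, ∃ l ∈ L, x = N * y + l := by
  have hsub : canonicalSpectrum N B L ⊆ {x | x ∈ canonicalSpectrum N B L ∧
      ∃ y ∈ canonicalSpectrum N B L, ∃ l ∈ L, x = N * y + l} := by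
    refine canonicalSpectrum_subset (fun C hC x hx => ⟨neg_mem_canonicalSpectrum hC hx, ?_⟩)
      fun x hx l hl => ⟨mul_add_mem_canonicalSpectrum hx.1 hl, x, hx.1, l, hl, rfl⟩
    obtain ⟨K, a, ha, rfl, haC⟩ := hC.1.exists_path hx
    obtain ⟨l, hl, he⟩ := ha.step 0
    refine ⟨-a 1, neg_mem_canonicalSpectrum hC (haC 1), l, hl, ?_⟩
    rw [← zero_add 1, ← he, mul_neg, mul_tau h.natCast_ne_zero]
    ring
  exact (hsub hx).2

theorem mul_add_injective (h : IsHadamardTriple N B L) {x x' : ℝ}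
    (hx : x ∈ periodGroup B) (hx' : x' ∈ periodGroup B) {l l' : ℤ}
    (hl : l ∈ L) (hl' : l' ∈ L) (he : (N : ℝ) * x + l = N * x' + l') : l = l' ∧ x = x' := by
  have hN := h.natCast_ne_zero
  have hll : l = l' := by
    refine h.eq_of_sub_div_mem hl hl' ?_
    rw [show ((l : ℝ) - l') / N = x' - x by field_simp; linarith]
    exact sub_mem hx' hx
  subst hll
  exact ⟨rfl, mul_left_cancel₀ hN (add_right_cancel he)⟩

end IsHadamardTriple

/-! ### The Fourier transform of the self-similar measure -/

theorem charFun_two_pi_mul (μ : Measure ℝ) (t : ℝ) :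
    charFun μ (2 * Real.pi * t) = ∫ x, (𝐞 (t * x) : ℂ) ∂μ := by
  simp_rw [charFun_apply_real, Real.fourierChar_apply]
  push_cast
  simp only [mul_assoc]

theorem integrable_fourierChar_mul (μ : Measure ℝ) [IsFiniteMeasure μ] (t : ℝ) :
    Integrable (fun x => (𝐞 (t * x) : ℂ)) μ :=
  Integrable.of_bound (C := 1) (by fun_prop)
    (Filter.Eventually.of_forall fun _ => (Circle.norm_coe _).le)

theorem IsSelfSimilarMeasure.charFun_eq {N : ℕ} {B : Finset ℤ} {μ : Measure ℝ}
    (hμ : IsSelfSimilarMeasure N B μ) (t : ℝ) :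
    charFun μ (2 * Real.pi * t) = maskFunction B (t / N) * charFun μ (2 * Real.pi * (t / N)) := by
  have := hμ.isProbabilityMeasure
  have hint (b : ℤ) : Integrable (fun x => (𝐞 (t * x) : ℂ)) (μ.map (tau N b)) := by
    have := Measure.isProbabilityMeasure_map (μ := μ) (measurable_tau N b).aemeasurable
    exact integrable_fourierChar_mul _ t
  have hbranch (b : ℤ) : ∫ x, (𝐞 (t * x) : ℂ) ∂μ.map (tau N b) =
      𝐞 (b * (t / N)) * charFun μ (2 * Real.pi * (t / N)) := by
    rw [integral_map (measurable_tau N b).aemeasurable (hint b).aestronglyMeasurable,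
      charFun_two_pi_mul, ← integral_const_mul]
    refine integral_congr_ae (Filter.Eventually.of_forall fun x => ?_)
    simp only [← Circle.coe_mul, ← AddChar.map_add_eq_mul, tau]
    ring_nf
  conv_lhs => rw [charFun_two_pi_mul, hμ.eq_sum]
  rw [integral_smul_measure, integral_finsetSum_measure fun b _ => hint b, maskFunction_eq,
    mul_assoc, Finset.sum_mul, Complex.real_smul]
  simp [hbranch]

namespace IsHadamardTriple

variable {N : ℕ} {B L : Finset ℤ}

theorem exists_sub_eq_mul_sub (h : IsHadamardTriple N B L) (h0 : 0 ∈ B) {μ : Measure ℝ}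
    (hμ : IsSelfSimilarMeasure N B μ) {x y : ℝ} (hx : x ∈ canonicalSpectrum N B L)
    (hy : y ∈ canonicalSpectrum N B L) (hne : charFun μ (2 * Real.pi * (x - y)) ≠ 0) :
    ∃ x' ∈ canonicalSpectrum N B L, ∃ y' ∈ canonicalSpectrum N B L,
      x - y = N * (x' - y') ∧ charFun μ (2 * Real.pi * (x' - y')) ≠ 0 := by
  have hN := h.natCast_ne_zero
  obtain ⟨x', hx', l, hl, rfl⟩ := h.exists_eq_mul_add hx
  obtain ⟨y', hy', l', hl', rfl⟩ := h.exists_eq_mul_add hy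
  have hdiff : x' - y' ∈ periodGroup B := sub_mem (canonicalSpectrum_subset_periodGroup h0 hx')
    (canonicalSpectrum_subset_periodGroup h0 hy')
  have hdiv : ((N : ℝ) * x' + l - (N * y' + l')) / N = ((l : ℝ) - l') / N + (x' - y') := by
    field_simp
    ring
  rw [hμ.charFun_eq, hdiv, maskFunction_add_of_mem _ hdiff] at hne
  obtain rfl : l = l' := by
    by_contra hll
    exact left_ne_zero_of_mul hne (h.maskFunction_sub_div hl hl' hll)
  refine ⟨x', hx', y', hy', by ring, ?_⟩
  simpa using right_ne_zero_of_mul hne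

theorem charFun_sub_eq_zero (h : IsHadamardTriple N B L) (h0 : 0 ∈ B) {μ : Measure ℝ}
    (hμ : IsSelfSimilarMeasure N B μ) {x y : ℝ} (hx : x ∈ canonicalSpectrum N B L)
    (hy : y ∈ canonicalSpectrum N B L) (hxy : x ≠ y) :
    charFun μ (2 * Real.pi * (x - y)) = 0 := by
  by_contra hne
  have hdiv (k : ℕ) : ∃ x' ∈ canonicalSpectrum N B L, ∃ y' ∈ canonicalSpectrum N B L,
      x - y = N ^ k * (x' - y') ∧ charFun μ (2 * Real.pi * (x' - y')) ≠ 0 := by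
    induction k with
    | zero => exact ⟨x, hx, y, hy, by simp, hne⟩
    | succ k ih =>
      obtain ⟨x₁, hx₁, y₁, hy₁, he₁, hne₁⟩ := ih
      obtain ⟨x₂, hx₂, y₂, hy₂, he₂, hne₂⟩ := h.exists_sub_eq_mul_sub h0 hμ hx₁ hy₁ hne₁
      exact ⟨x₂, hx₂, y₂, hy₂, by rw [he₁, he₂, pow_succ, mul_assoc], hne₂⟩
  obtain ⟨D, hD, hint⟩ := exists_mul_eq_intCast_of_mem_periodGroup h.two_le_card
  have hsub {x y : ℝ} (hx : x ∈ canonicalSpectrum N B L) (hy : y ∈ canonicalSpectrum N B L) :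
      ∃ n : ℤ, D * (x - y) = n := hint _ (sub_mem (canonicalSpectrum_subset_periodGroup h0 hx)
    (canonicalSpectrum_subset_periodGroup h0 hy))
  obtain ⟨z, hz⟩ := hsub hx hy
  have hz0 : z ≠ 0 := by
    rintro rfl
    simp [hD, sub_eq_zero, hxy] at hz
  have hdvd : N ^ z.natAbs ∣ z.natAbs := by
    obtain ⟨x', hx', y', hy', he, -⟩ := hdiv z.natAbs
    obtain ⟨w, hw⟩ := hsub hx' hy'
    rw [← Int.natCast_dvd, Nat.cast_pow]
    refine ⟨w, ?_⟩
    rw [he, mul_left_comm, hw] at hz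
    exact_mod_cast hz.symm
  exact (Nat.lt_pow_self h.two_le).not_ge (Nat.le_of_dvd (Int.natAbs_pos.2 hz0) hdvd)

end IsHadamardTriple

/-! ### Exponentials in `L²` -/

/-- The exponential `x ↦ e^{2πitx}` as an element of `L²(μ)`. -/
def expLp (μ : Measure ℝ) [IsFiniteMeasure μ] (t : ℝ) : Lp ℂ 2 μ :=
  BoundedContinuousFunction.toLp 2 μ ℂ
    (BoundedContinuousFunction.innerProbChar (2 * Real.pi * t))

section Exponentials

variable {μ : Measure ℝ}

theorem coeFn_expLp [IsFiniteMeasure μ] (t : ℝ) :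
    (expLp μ t : ℝ → ℂ) =ᵐ[μ] fun x => (𝐞 (t * x) : ℂ) := by
  filter_upwards [BoundedContinuousFunction.coeFn_toLp 2 μ ℂ
    (BoundedContinuousFunction.innerProbChar (2 * Real.pi * t))] with x hx
  rw [expLp, hx, BoundedContinuousFunction.innerProbChar_apply, Real.fourierChar_apply]
  simp only [RCLike.inner_apply, conj_trivial, Complex.ofReal_mul]
  push_cast
  ring_nf

theorem inner_expLp_left [IsFiniteMeasure μ] (t : ℝ) (f : Lp ℂ 2 μ) :
    inner ℂ (expLp μ t) f = ∫ x, f x * (𝐞 (-(t * x)) : ℂ) ∂μ := by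
  rw [L2.inner_def]
  refine integral_congr_ae ?_
  filter_upwards [coeFn_expLp (μ := μ) t] with x hx
  rw [hx, RCLike.inner_apply, ← star_fourierChar, RCLike.star_def]

theorem inner_expLp [IsFiniteMeasure μ] (s t : ℝ) :
    inner ℂ (expLp μ s) (expLp μ t) = charFun μ (2 * Real.pi * (t - s)) := by
  rw [inner_expLp_left, charFun_two_pi_mul]
  refine integral_congr_ae ?_
  filter_upwards [coeFn_expLp (μ := μ) t] with x hx
  rw [hx, ← Circle.coe_mul, ← AddChar.map_add_eq_mul]
  ring_nf

theorem norm_expLp [IsProbabilityMeasure μ] (t : ℝ) : ‖expLp μ t‖ = 1 := by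
  rw [norm_eq_sqrt_re_inner (𝕜 := ℂ), inner_expLp]
  simp

theorem orthonormal_expLp [IsProbabilityMeasure μ] {Λ : Set ℝ}
    (h : ∀ x ∈ Λ, ∀ y ∈ Λ, x ≠ y → charFun μ (2 * Real.pi * (x - y)) = 0) :
    Orthonormal ℂ fun l : Λ => expLp μ l := by
  refine ⟨fun l => norm_expLp _, fun l l' hne => ?_⟩
  simp only [inner_expLp]
  exact h _ l'.2 _ l.2 fun e => hne (Subtype.ext e.symm)

theorem isSpectralPair_iff [IsProbabilityMeasure μ] {Λ : Set ℝ} :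
    IsSpectralPair μ Λ ↔
      Λ.Countable ∧ ∃ e : HilbertBasis Λ ℂ (Lp ℂ 2 μ), ∀ l : Λ, e l = expLp μ l := by
  refine and_congr_right fun _ => exists_congr fun e => forall_congr' fun l => ?_
  simp_rw [← fourierChar_eq_exp]
  constructor
  · exact fun h => Lp.ext (h.trans (coeFn_expLp _).symm)
  · intro h
    rw [h]
    exact coeFn_expLp _

theorem charFun_withDensity_ofReal {u : ℝ → ℝ} (hu : AEMeasurable u μ) (s : ℝ) :
    charFun (μ.withDensity fun x => ENNReal.ofReal (u x)) s =
      ∫ x, ((max (u x) 0 : ℝ) : ℂ) * Complex.exp (s * x * Complex.I) ∂μ := by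
  rw [charFun_apply_real, integral_withDensity_eq_integral_toReal_smul₀ hu.ennreal_ofReal
    (Filter.Eventually.of_forall fun _ => ENNReal.ofReal_lt_top)]
  simp only [ENNReal.toReal_ofReal', Complex.real_smul]

/-- Uniqueness of characteristic functions, applied to the densities `u⁺` and `u⁻`. -/
theorem ae_eq_zero_of_integral_ofReal_mul_exp [IsFiniteMeasure μ] {u : ℝ → ℝ}
    (hu : Integrable u μ)
    (h : ∀ s : ℝ, ∫ x, (u x : ℂ) * Complex.exp (s * x * Complex.I) ∂μ = 0) : u =ᵐ[μ] 0 := by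
  have hmeas := hu.1.aemeasurable
  have := isFiniteMeasure_withDensity_ofReal hu.2
  have := isFiniteMeasure_withDensity_ofReal hu.neg.2
  have hint {w : ℝ → ℝ} (hw : Integrable w μ) (s : ℝ) :
      Integrable (fun x => ((max (w x) 0 : ℝ) : ℂ) * Complex.exp (s * x * Complex.I)) μ := by
    refine hw.pos_part.ofReal.mul_bdd (c := 1) (by fun_prop)
      (Filter.Eventually.of_forall fun x => ?_)
    rw [← Complex.ofReal_mul, Complex.norm_exp_ofReal_mul_I]
  have heq : μ.withDensity (fun x => ENNReal.ofReal (u x)) =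
      μ.withDensity fun x => ENNReal.ofReal ((-u) x) := by
    refine Measure.ext_of_charFun (funext fun s => sub_eq_zero.1 ?_)
    rw [charFun_withDensity_ofReal hmeas, charFun_withDensity_ofReal hmeas.neg,
      ← integral_sub (hint hu s) (hint hu.neg s), ← h s]
    simp_rw [← sub_mul, ← Complex.ofReal_sub, Pi.neg_apply, max_zero_sub_max_neg_zero_eq_self]
  filter_upwards [(withDensity_eq_iff hmeas.ennreal_ofReal hmeas.neg.ennreal_ofReal
    hu.lintegral_lt_top.ne).1 heq] with x hx
  have hparts := congrArg ENNReal.toReal hx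
  rw [ENNReal.toReal_ofReal', ENNReal.toReal_ofReal'] at hparts
  rw [← max_zero_sub_max_neg_zero_eq_self (u x), hparts, Pi.neg_apply, sub_self, Pi.zero_apply]

theorem eq_zero_of_inner_expLp [IsFiniteMeasure μ] (f : Lp ℂ 2 μ)
    (h : ∀ t, inner ℂ (expLp μ t) f = 0) : f = 0 := by
  have hf : Integrable f μ := (Lp.memLp f).integrable one_le_two
  have hfc : Integrable (fun x => starRingEnd ℂ (f x)) μ := (Lp.memLp f).star.integrable one_le_two
  have hexp (t : ℝ) : ∫ x, f x * (𝐞 (t * x) : ℂ) ∂μ = 0 := by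
    simpa only [inner_expLp_left, neg_mul, neg_neg] using h (-t)
  have hconj (t : ℝ) : ∫ x, starRingEnd ℂ (f x) * (𝐞 (t * x) : ℂ) ∂μ = 0 := by
    rw [← map_zero (starRingEnd ℂ), ← hexp (-t), ← integral_conj]
    simp_rw [map_mul, ← RCLike.star_def, star_fourierChar, neg_mul, neg_neg]
  have hint {g : ℝ → ℂ} (hg : Integrable g μ) (t : ℝ) :
      Integrable (fun x => g x * (𝐞 (t * x) : ℂ)) μ :=
    hg.mul_bdd (c := 1) (by fun_prop)
      (Filter.Eventually.of_forall fun _ => (Circle.norm_coe _).le)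
  have hre (c : ℂ) : (fun x => (c * f x).re) =ᵐ[μ] 0 := by
    refine ae_eq_zero_of_integral_ofReal_mul_exp (hf.const_mul c).re fun s => ?_
    have hexpand (x : ℝ) : ((c * f x).re : ℂ) * Complex.exp (s * x * Complex.I) =
        2⁻¹ * (c * (f x * (𝐞 (s / (2 * Real.pi) * x) : ℂ)) +
          starRingEnd ℂ c * (starRingEnd ℂ (f x) * (𝐞 (s / (2 * Real.pi) * x) : ℂ))) := by
      rw [Complex.re_eq_add_conj, map_mul, Real.fourierChar_apply,
        show 2 * Real.pi * (s / (2 * Real.pi) * x) = s * x by field_simp, Complex.ofReal_mul]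
      ring
    change ∫ x, ((c * f x).re : ℂ) * _ ∂μ = 0
    simp_rw [hexpand]
    rw [integral_const_mul, integral_add ((hint hf _).const_mul c)
      ((hint hfc _).const_mul _), integral_const_mul,
      integral_const_mul, hexp, hconj]
    simp
  refine Lp.ext ?_
  filter_upwards [hre 1, hre (-Complex.I), Lp.coeFn_zero ℂ 2 μ] with x hx hx' h0
  rw [h0]
  exact Complex.ext (by simpa using hx) (by simpa using hx')

end Exponentials

section Analyticity

open scoped ContDiff

/-- `s ↦ 2πis`, with `s` clipped to `[-|R|, |R|]`: a bounded function, so that its exponential can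
be formed in a Banach algebra. -/
def clippedCoordinate (R : ℝ) : BoundedContinuousFunction ℝ ℂ :=
  BoundedContinuousFunction.ofNormedAddCommGroup
    (fun s : ℝ => 2 * Real.pi * Complex.I * ((max (-|R|) (min |R| s) : ℝ) : ℂ)) (by fun_prop)
    (2 * Real.pi * |R|) fun s => by
      have hclip : |max (-|R|) (min |R| s)| ≤ |R| :=
        abs_le.2 ⟨le_max_left _ _, max_le (neg_le_self (abs_nonneg R)) (min_le_left _ _)⟩
      simpa [abs_of_pos Real.pi_pos] using
        mul_le_mul_of_nonneg_left hclip Real.two_pi_pos.le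

theorem exp_boundedContinuousFunction_apply (g : BoundedContinuousFunction ℝ ℂ) (s : ℝ) :
    (NormedSpace.exp g) s = Complex.exp (g s) := by
  let eval : BoundedContinuousFunction ℝ ℂ →+* ℂ :=
    { toFun := fun f => f s
      map_one' := rfl
      map_mul' := fun _ _ => rfl
      map_zero' := rfl
      map_add' := fun _ _ => rfl }
  have heval : Continuous eval := (BoundedContinuousFunction.evalCLM ℂ s).continuous
  rw [Complex.exp_eq_exp_ℂ]
  exact NormedSpace.map_exp eval heval g

variable {μ : Measure ℝ} [IsFiniteMeasure μ] {R : ℝ}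

theorem expLp_eq_toLp_exp (hR : ∀ᵐ x ∂μ, |x| ≤ R) (t : ℝ) :
    expLp μ t = BoundedContinuousFunction.toLp 2 μ ℂ
      (NormedSpace.exp (t • clippedCoordinate R)) := by
  refine Lp.ext ((coeFn_expLp t).trans ?_)
  filter_upwards [hR, BoundedContinuousFunction.coeFn_toLp 2 μ ℂ
    (NormedSpace.exp (t • clippedCoordinate R))] with x hx hc
  obtain ⟨hx₁, hx₂⟩ := abs_le.1 (hx.trans (le_abs_self R))
  rw [hc, exp_boundedContinuousFunction_apply, fourierChar_eq_exp]
  congr 1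
  simp only [BoundedContinuousFunction.coe_smul, clippedCoordinate,
    BoundedContinuousFunction.coe_ofNormedAddCommGroup, min_eq_right hx₂, max_eq_right hx₁,
    Complex.real_smul]
  push_cast
  ring

theorem contDiff_expLp (hR : ∀ᵐ x ∂μ, |x| ≤ R) : ContDiff ℝ ω (expLp μ) := by
  have hexp : ContDiff ℝ ω (NormedSpace.exp : BoundedContinuousFunction ℝ ℂ → _) :=
    contDiff_omega_iff_analyticOnNhd.2 fun g _ => NormedSpace.exp_analytic g
  let toLp : BoundedContinuousFunction ℝ ℂ →L[ℝ] Lp ℂ 2 μ :=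
    (BoundedContinuousFunction.toLp 2 μ ℂ).restrictScalars ℝ
  rw [funext (expLp_eq_toLp_exp hR)]
  exact toLp.contDiff.comp (hexp.comp (contDiff_id.smul contDiff_const))

theorem analyticOnNhd_norm_sq_expLp (hR : ∀ᵐ x ∂μ, |x| ≤ R) {E : Type*}
    [NormedAddCommGroup E] [InnerProductSpace ℝ E] (T : Lp ℂ 2 μ →L[ℝ] E) :
    AnalyticOnNhd ℝ (fun t => ‖T (expLp μ t)‖ ^ 2) Set.univ :=
  contDiff_omega_iff_analyticOnNhd.1 ((T.contDiff.comp (contDiff_expLp hR)).norm_sq ℝ)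

end Analyticity

section Support

variable {N : ℕ} {B : Finset ℤ}

theorem abs_digitSeries_le (hN : 2 ≤ N) (w : ℕ → B) :
    |digitSeries N B w| ≤ (B.sup Int.natAbs : ℕ) := by
  rw [← Real.norm_eq_abs]
  refine tsum_of_norm_bounded (hasSum_geometric_two' _) fun k => ?_
  have hN' : (2 : ℝ) ≤ N := by exact_mod_cast hN
  rw [norm_div, norm_pow, Real.norm_eq_abs, Real.norm_natCast, div_div, ← pow_succ']
  gcongr
  exact abs_le_sup_natAbs (w k).2

theorem ae_abs_le_selfSimilarMeasure (hN : 2 ≤ N) (hB : B.Nonempty) :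
    ∀ᵐ x ∂selfSimilarMeasure N B hB, |x| ≤ ((B.sup Int.natAbs : ℕ) : ℝ) :=
  (ae_map_iff (measurable_digitSeries N B).aemeasurable
    (measurableSet_le measurable_abs measurable_const)).2
    (Filter.Eventually.of_forall (abs_digitSeries_le hN))

end Support

section CoefficientOperator

variable {ι E : Type*} [NormedAddCommGroup E] [InnerProductSpace ℂ E] [CompleteSpace E]
  {v : ι → E} (hv : Orthonormal ℂ v)

/-- The coefficient operator `f ↦ (⟨v i, f⟩)_i` of an orthonormal family, as the adjoint of the
isometry `c ↦ ∑ i, c i • v i`. -/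
def coefficientOperator : E →L[ℂ] lp (fun _ : ι => ℂ) 2 :=
  hv.orthogonalFamily.linearIsometry.toContinuousLinearMap.adjoint

theorem coefficientOperator_apply (f : E) (i : ι) :
    coefficientOperator hv f i = inner ℂ (v i) f := by
  classical
  have hsingle : hv.orthogonalFamily.linearIsometry (lp.single 2 i (1 : ℂ)) = v i := by
    simp [OrthogonalFamily.linearIsometry_apply_single]
  rw [← hsingle, ← LinearIsometry.coe_toContinuousLinearMap,
    ← ContinuousLinearMap.adjoint_inner_right, lp.inner_single_left]
  simp [coefficientOperator]

theorem norm_coefficientOperator_apply_le (f : E) : ‖coefficientOperator hv f‖ ≤ ‖f‖ := by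
  refine ContinuousLinearMap.le_of_opNorm_le _ ?_ f |>.trans_eq (one_mul _)
  rw [coefficientOperator, LinearIsometryEquiv.norm_map]
  exact LinearIsometry.norm_toContinuousLinearMap_le _

theorem mem_closure_span_of_norm_coefficientOperator {f : E}
    (hf : ‖coefficientOperator hv f‖ = ‖f‖) :
    f ∈ (Submodule.span ℂ (Set.range v)).topologicalClosure := by
  set V := hv.orthogonalFamily.linearIsometry
  set c := coefficientOperator hv f with hc
  have hinner : RCLike.re (inner ℂ f (V c)) = ‖c‖ ^ 2 := by
    rw [norm_sq_eq_re_inner (𝕜 := ℂ), ← LinearIsometry.coe_toContinuousLinearMap,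
      ← ContinuousLinearMap.adjoint_inner_left, hc, coefficientOperator]
  have hzero : ‖f - V c‖ ^ 2 = 0 := by
    rw [norm_sub_sq (𝕜 := ℂ), hinner, V.norm_map, hf]
    ring
  have hmem : f ∈ V.toLinearMap.range := by
    rw [sub_eq_zero.1 (norm_eq_zero.1 (pow_eq_zero_iff two_ne_zero |>.1 hzero))]
    exact ⟨c, rfl⟩
  rw [hv.orthogonalFamily.range_linearIsometry] at hmem
  simpa [← LinearMap.span_singleton_eq_range, ← Submodule.span_iUnion] using hmem

end CoefficientOperator

/-! ### Invariant sets and harmonic functions of the transfer operator -/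

theorem exists_isPeriodicPath_of_finite {N : ℕ} {L : Finset ℤ} {Z : Set ℝ} (hfin : Z.Finite)
    (hne : Z.Nonempty) (hsucc : ∀ x ∈ Z, ∃ l ∈ L, tau N l x ∈ Z) :
    ∃ K a, IsPeriodicPath N L K a ∧ a 0 ∈ Z := by
  choose! l hl hlZ using hsucc
  obtain ⟨x, hx⟩ := hne
  let f : ℝ → ℝ := fun y => tau N (l y) y
  have hmem (n : ℕ) : f^[n] x ∈ Z := Set.MapsTo.iterate (fun y hy => hlZ y hy) n hx
  obtain ⟨i, j, hij, he⟩ := hfin.exists_lt_map_eq_of_forall_mem hmem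
  refine ⟨j - i, fun n => f^[n + i] x, ⟨Nat.sub_pos_of_lt hij, fun n => ?_, fun n => ?_⟩, hmem _⟩
  · refine ⟨l (f^[n + i] x), hl _ (hmem _), ?_⟩
    rw [add_right_comm, Function.iterate_succ_apply']
  · rw [add_assoc, Nat.sub_add_cancel hij.le, Function.iterate_add_apply, ← he,
      ← Function.iterate_add_apply]

/-- `Z` is closed under those transitions `x ↦ τ_ℓ x`, `ℓ ∈ L`, that have positive weight
`|m_B(τ_ℓ x)|²`. -/
def IsMaskInvariant (N : ℕ) (B L : Finset ℤ) (Z : Set ℝ) : Prop :=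
  ∀ x ∈ Z, ∀ l ∈ L, maskFunction B (tau N l x) ≠ 0 → tau N l x ∈ Z

section Invariant

variable {N : ℕ} {B L : Finset ℤ} {Z : Set ℝ}

theorem IsHadamardTriple.exists_maskFunction_tau_ne_zero (h : IsHadamardTriple N B L) (x : ℝ) :
    ∃ l ∈ L, maskFunction B (tau N l x) ≠ 0 := by
  by_contra! hzero
  refine zero_ne_one ((Finset.sum_eq_zero fun l hl => ?_).symm.trans
    (h.sum_norm_maskFunction_tau_sq x))
  rw [hzero l hl, norm_zero, zero_pow two_ne_zero]

namespace IsMaskInvariant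

theorem injOn_nsmul (hZ : IsMaskInvariant N B L Z) (h : IsHadamardTriple N B L)
    (hfin : Z.Finite) :
    Set.InjOn (fun u : ℝ ⧸ periodGroup B => N • u)
      ((fun x : ℝ => (x : ℝ ⧸ periodGroup B)) '' Z) := by
  refine (hfin.image _).injOn_of_encard_image_eq
    (le_antisymm (Set.encard_image_le _ _) (Set.encard_le_encard ?_))
  rintro _ ⟨x, hx, rfl⟩
  obtain ⟨l, hl, hm⟩ := h.exists_maskFunction_tau_ne_zero x
  exact ⟨_, Set.mem_image_of_mem _ (hZ x hx l hl hm), nsmul_mk_tau h.natCast_ne_zero B l x⟩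

theorem norm_maskFunction_tau_eq_one (hZ : IsMaskInvariant N B L Z) (h : IsHadamardTriple N B L)
    (hfin : Z.Finite) {x : ℝ} (hx : x ∈ Z) {l : ℤ} (hl : l ∈ L)
    (hm : maskFunction B (tau N l x) ≠ 0) : ‖maskFunction B (tau N l x)‖ = 1 := by
  have hN := h.natCast_ne_zero
  have hunique : ∀ l' ∈ L, maskFunction B (tau N l' x) ≠ 0 → l' = l := by
    intro l' hl' hm'
    have hmk : (tau N l x : ℝ ⧸ periodGroup B) = tau N l' x :=
      hZ.injOn_nsmul h hfin ⟨_, hZ x hx l hl hm, rfl⟩ ⟨_, hZ x hx l' hl' hm', rfl⟩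
        (by simp only [nsmul_mk_tau hN])
    refine h.eq_of_sub_div_mem hl' hl ?_
    rw [QuotientAddGroup.eq] at hmk
    rwa [show ((l' : ℝ) - l) / N = -tau N l x + tau N l' x by rw [tau, tau]; ring]
  have hsum := h.sum_norm_maskFunction_tau_sq x
  rw [Finset.sum_eq_single_of_mem l hl fun l' hl' hne => ?_] at hsum
  · exact (pow_eq_one_iff_of_nonneg (norm_nonneg _) two_ne_zero).1 hsum
  · rw [not_imp_comm.1 (hunique l' hl') hne, norm_zero, zero_pow two_ne_zero]

theorem exists_isPeriodicPath (hZ : IsMaskInvariant N B L Z) (h : IsHadamardTriple N B L)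
    (hfin : Z.Finite) (hne : Z.Nonempty) :
    ∃ K a, IsPeriodicPath N L K a ∧ a 0 ∈ Z ∧ ‖maskFunction B (a 0)‖ = 1 := by
  have hnext : ∀ x ∈ Z, ∃ l ∈ L, tau N l x ∈ {y ∈ Z | ‖maskFunction B y‖ = 1} := by
    intro x hx
    obtain ⟨l, hl, hm⟩ := h.exists_maskFunction_tau_ne_zero x
    exact ⟨l, hl, hZ x hx l hl hm, hZ.norm_maskFunction_tau_eq_one h hfin hx hl hm⟩
  obtain ⟨x, hx⟩ := hne
  obtain ⟨l, -, hl⟩ := hnext x hx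
  exact exists_isPeriodicPath_of_finite (hfin.subset (Set.sep_subset _ _)) ⟨_, hl⟩
    fun y hy => hnext y hy.1

end IsMaskInvariant

/-- `Q` is a fixed point of the transfer operator `Q ↦ ∑_ℓ |m_B ∘ τ_ℓ|² · (Q ∘ τ_ℓ)`. -/
def IsHarmonic (N : ℕ) (B L : Finset ℤ) (Q : ℝ → ℝ) : Prop :=
  ∀ x, ∑ l ∈ L, ‖maskFunction B (tau N l x)‖ ^ 2 * Q (tau N l x) = Q x

namespace IsHarmonic

variable {Q : ℝ → ℝ}

theorem isMaskInvariant_argmin (hQ : IsHarmonic N B L Q) (h : IsHadamardTriple N B L)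
    {S : Set ℝ} (hS : ∀ x ∈ S, ∀ l ∈ L, tau N l x ∈ S) {m : ℝ} (hm : ∀ x ∈ S, m ≤ Q x) :
    IsMaskInvariant N B L {x ∈ S | Q x = m} := by
  rintro x ⟨hxS, hxm⟩ l hl hmask
  refine ⟨hS x hxS l hl, sub_eq_zero.1 ?_⟩
  have hzero : ∑ l ∈ L, ‖maskFunction B (tau N l x)‖ ^ 2 * (Q (tau N l x) - m) = 0 := by
    simp only [mul_sub, Finset.sum_sub_distrib]
    rw [hQ, ← Finset.sum_mul, h.sum_norm_maskFunction_tau_sq, hxm, one_mul, sub_self]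
  have hterm := (Finset.sum_eq_zero_iff_of_nonneg fun l' hl' =>
    mul_nonneg (sq_nonneg _) (sub_nonneg.2 (hm _ (hS x hxS l' hl')))).1 hzero l hl
  exact (mul_eq_zero.1 hterm).resolve_left (pow_ne_zero _ (norm_ne_zero_iff.2 hmask))

/-- The minimum of `Q` on a compact interval is attained on an invariant set. If that set is finite
it contains an extreme cycle; otherwise `Q` is constant by analyticity. -/
theorem one_le (hQ : IsHarmonic N B L Q) (h : IsHadamardTriple N B L) (h0B : 0 ∈ B) (h0L : 0 ∈ L)
    (hana : AnalyticOnNhd ℝ Q Set.univ)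
    (hspec : ∀ x, -x ∈ canonicalSpectrum N B L → 1 ≤ Q x) (x : ℝ) : 1 ≤ Q x := by
  set R : ℝ := max |x| (L.sup Int.natAbs : ℕ)
  let S := Set.Icc (-R) R
  have hxS : x ∈ S := abs_le.1 (le_max_left _ _)
  have hS : ∀ y ∈ S, ∀ l ∈ L, tau N l y ∈ S := fun y hy l hl => abs_le.1 <|
    (abs_tau_le h.two_le ((abs_le_sup_natAbs hl).trans (le_max_right _ _)) (abs_le.2 hy)).trans_eq
      (add_self_div_two R)
  obtain ⟨x₀, hx₀, hmin⟩ :=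
    (isCompact_Icc (a := -R)).exists_isMinOn ⟨x, hxS⟩ (hana.continuousOn.mono S.subset_univ)
  refine le_trans ?_ (hmin hxS)
  by_cases hfin : {y ∈ S | Q y = Q x₀}.Finite
  · obtain ⟨K, a, ha, ⟨-, hmin₀⟩, hnorm⟩ :=
      (hQ.isMaskInvariant_argmin h hS fun y hy => hmin hy).exists_isPeriodicPath h hfin
        ⟨x₀, hx₀, rfl⟩
    rw [← hmin₀]
    exact hspec _ (h.neg_mem_canonicalSpectrum_of_path ha
      (mem_periodGroup_of_norm_maskFunction h0B hnorm))
  · obtain ⟨y, -, hacc⟩ := Set.Infinite.exists_accPt_of_subset_isCompact hfin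
      isCompact_Icc fun y hy => hy.1
    have hconst : Q = fun _ => Q x₀ := hana.eq_of_frequently_eq analyticOnNhd_const
      ((accPt_iff_frequently_nhdsNE.1 hacc).mono fun z hz => hz.2)
    have hzero := hspec 0 (by simpa using h.zero_mem_canonicalSpectrum h0L)
    rwa [hconst] at hzero

end IsHarmonic

end Invariant

/-! ### Completeness of the canonical spectrum -/

theorem hasSum_norm_charFun_sq {μ : Measure ℝ} [IsProbabilityMeasure μ] {Λ : Set ℝ}
    (hv : Orthonormal ℂ fun y : Λ => expLp μ y) (x : ℝ) :
    HasSum (fun y : Λ => ‖charFun μ (2 * Real.pi * (x + y))‖ ^ 2)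
      (‖coefficientOperator hv (expLp μ (-x))‖ ^ 2) := by
  have hcoeff := lp.hasSum_norm (p := 2) (by norm_num) (coefficientOperator hv (expLp μ (-x)))
  simp only [ENNReal.toReal_ofNat, Real.rpow_ofNat, coefficientOperator_apply,
    inner_expLp] at hcoeff
  convert hcoeff using 3 with y
  rw [← RCLike.norm_conj, ← charFun_neg]
  ring_nf

namespace IsHadamardTriple

variable {N : ℕ} {B L : Finset ℤ}

theorem bijective_mul_add (h : IsHadamardTriple N B L) (h0 : 0 ∈ B) :
    Function.Bijective fun u : L × canonicalSpectrum N B L =>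
      (⟨N * u.2 + u.1, mul_add_mem_canonicalSpectrum u.2.2 u.1.2⟩ : canonicalSpectrum N B L) := by
  have hsub := canonicalSpectrum_subset_periodGroup (N := N) (L := L) h0
  constructor
  · intro u v huv
    obtain ⟨hl, hx⟩ := h.mul_add_injective (hsub u.2.2) (hsub v.2.2) u.1.2 v.1.2
      (congrArg Subtype.val huv)
    exact Prod.ext (Subtype.ext hl) (Subtype.ext hx)
  · intro x
    obtain ⟨y, hy, l, hl, he⟩ := h.exists_eq_mul_add x.2
    exact ⟨(⟨l, hl⟩, ⟨y, hy⟩), Subtype.ext he.symm⟩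

theorem isHarmonic_of_hasSum (h : IsHadamardTriple N B L) (h0 : 0 ∈ B) {μ : Measure ℝ}
    (hμ : IsSelfSimilarMeasure N B μ) {Q : ℝ → ℝ}
    (hQ : ∀ x, HasSum (fun y : canonicalSpectrum N B L =>
      ‖charFun μ (2 * Real.pi * (x + y))‖ ^ 2) (Q x)) : IsHarmonic N B L Q := by
  intro x
  have hN := h.natCast_ne_zero
  have hbranch (l : ℤ) (y : canonicalSpectrum N B L) :
      ‖charFun μ (2 * Real.pi * (x + (N * y + l)))‖ ^ 2 =
        ‖maskFunction B (tau N l x)‖ ^ 2 * ‖charFun μ (2 * Real.pi * (tau N l x + y))‖ ^ 2 := by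
    have hdiv : (x + (N * y + l)) / N = tau N l x + y := by
      rw [tau]
      field_simp
      ring
    rw [hμ.charFun_eq, hdiv, norm_mul, mul_pow,
      maskFunction_add_of_mem _ (canonicalSpectrum_subset_periodGroup h0 y.2)]
  have hsum := (Equiv.ofBijective _ (h.bijective_mul_add h0)).hasSum_iff.2 (hQ x)
  have hfiber := hsum.prod_fiberwise (g := fun l : L =>
    ‖maskFunction B (tau N l x)‖ ^ 2 * Q (tau N l x)) fun l => by
      simpa only [Function.comp_apply, Equiv.ofBijective_apply, hbranch] using
        (hQ (tau N l x)).mul_left (‖maskFunction B (tau N l x)‖ ^ 2)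
  rw [← Finset.sum_coe_sort L]
  exact (hasSum_fintype _).unique hfiber

theorem isSpectralPair (h : IsHadamardTriple N B L) (h0B : 0 ∈ B) (h0L : 0 ∈ L) :
    IsSpectralPair (selfSimilarMeasure N B h.nonempty) (canonicalSpectrum N B L) := by
  set μ := selfSimilarMeasure N B h.nonempty
  have hμ : IsSelfSimilarMeasure N B μ := isSelfSimilarMeasure_selfSimilarMeasure h.two_le B _
  have := hμ.isProbabilityMeasure
  have hv : Orthonormal ℂ fun y : canonicalSpectrum N B L => expLp μ y :=
    orthonormal_expLp fun x hx y hy hne => h.charFun_sub_eq_zero h0B hμ hx hy hne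
  let Q : ℝ → ℝ := fun x => ‖coefficientOperator hv (expLp μ (-x))‖ ^ 2
  have hsum (x : ℝ) : HasSum
      (fun y : canonicalSpectrum N B L => ‖charFun μ (2 * Real.pi * (x + y))‖ ^ 2) (Q x) :=
    hasSum_norm_charFun_sq hv x
  have hana : AnalyticOnNhd ℝ Q Set.univ :=
    (analyticOnNhd_norm_sq_expLp (ae_abs_le_selfSimilarMeasure h.two_le h.nonempty)
      ((coefficientOperator hv).restrictScalars ℝ)).comp analyticOnNhd_id.neg
      fun _ _ => Set.mem_univ _
  have hspec (x : ℝ) (hx : -x ∈ canonicalSpectrum N B L) : 1 ≤ Q x := by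
    simpa using le_hasSum (hsum x) ⟨-x, hx⟩ fun _ _ => sq_nonneg _
  have hmem (t : ℝ) : expLp μ t ∈ (Submodule.span ℂ (Set.range
      fun y : canonicalSpectrum N B L => expLp μ y)).topologicalClosure := by
    refine mem_closure_span_of_norm_coefficientOperator hv
      (le_antisymm (norm_coefficientOperator_apply_le hv _) ?_)
    have hone := (h.isHarmonic_of_hasSum h0B hμ hsum).one_le h h0B h0L hana hspec (-t)
    simp only [Q, neg_neg] at hone
    rw [norm_expLp]
    exact (one_le_sq_iff₀ (norm_nonneg _)).1 hone
  have hbot : (Submodule.span ℂ (Set.range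
      fun y : canonicalSpectrum N B L => expLp μ y))ᗮ = ⊥ := by
    refine (Submodule.eq_bot_iff _).2 fun f hf => ?_
    rw [← Submodule.orthogonal_closure] at hf
    exact eq_zero_of_inner_expLp f fun t => hf _ (hmem t)
  refine isSpectralPair_iff.2 ⟨countable_canonicalSpectrum h0B h.two_le_card,
    HilbertBasis.mkOfOrthogonalEqBot hv hbot, fun y => ?_⟩
  rw [HilbertBasis.coe_mkOfOrthogonalEqBot]

end IsHadamardTriple

/-! ### Denominators of periodic points -/

theorem emultiplicity_pow_sub_one {p : ℕ} (hp : p.Prime) {y : ℤ} (hy : (p : ℤ) ∣ y - 1)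
    (hy2 : p = 2 → 4 ∣ y - 1) (r : ℕ) :
    emultiplicity (p : ℤ) (y ^ r - 1) =
      emultiplicity (p : ℤ) (y - 1) + emultiplicity (p : ℤ) r := by
  have hpy : ¬(p : ℤ) ∣ y := fun hdvd =>
    (Nat.prime_iff_prime_int.1 hp).not_dvd_one ((dvd_sub_right hdvd).1 hy)
  rcases hp.eq_two_or_odd' with rfl | hodd
  · simpa using Int.two_pow_sub_pow' r (y := 1) (hy2 rfl) hpy
  · simpa [Int.natCast_emultiplicity] using Int.emultiplicity_pow_sub_pow hp hodd hy hpy r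

theorem dvd_sub_one_mul_of_dvd_pow_sub_one {q r : ℕ} {y : ℤ}
    (hy : ∀ p : ℕ, p.Prime → p ∣ q → (p : ℤ) ∣ y - 1 ∧ (p = 2 → 4 ∣ y - 1))
    (h : (q : ℤ) ∣ y ^ r - 1) : (q : ℤ) ∣ (y - 1) * r := by
  rw [Int.natCast_dvd, Nat.dvd_iff_prime_pow_dvd_dvd]
  intro p j hp hpj
  rcases eq_or_ne j 0 with rfl | hj
  · simp
  obtain ⟨hp1, hp2⟩ := hy p hp ((dvd_pow_self p hj).trans hpj)
  rw [← Int.natCast_dvd, Nat.cast_pow, pow_dvd_iff_le_emultiplicity,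
    emultiplicity_mul (Nat.prime_iff_prime_int.1 hp), ← emultiplicity_pow_sub_one hp hp1 hp2,
    ← pow_dvd_iff_le_emultiplicity, ← Nat.cast_pow]
  exact (Int.natCast_dvd_natCast.2 hpj).trans h

theorem dvd_pow_totient_sub_one_mul {N P q r m : ℕ} (hcop : P.Coprime N) (hqP : q ∣ P ^ m)
    (hq : (q : ℤ) ∣ (N : ℤ) ^ r - 1) : (q : ℤ) ∣ ((N : ℤ) ^ (2 * P.totient) - 1) * r := by
  refine dvd_sub_one_mul_of_dvd_pow_sub_one (fun p hp hpq => ?_) ?_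
  · have hpP : p ∣ P := hp.dvd_of_dvd_pow (hpq.trans hqP)
    have hdvd : (p : ℤ) ∣ (N : ℤ) ^ P.totient - 1 := by
      refine (Int.natCast_dvd_natCast.2 hpP).trans ?_
      simpa using Nat.modEq_iff_dvd.1 (Nat.ModEq.pow_totient hcop.symm).symm
    have hfactor : (N : ℤ) ^ (2 * P.totient) - 1 =
        ((N : ℤ) ^ P.totient + 1) * ((N : ℤ) ^ P.totient - 1) := by ring
    refine ⟨hfactor ▸ hdvd.mul_left _, fun h2 => ?_⟩
    subst h2
    rw [hfactor]
    have hplus : (2 : ℤ) ∣ (N : ℤ) ^ P.totient + 1 := by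
      push_cast at hdvd
      omega
    simpa using mul_dvd_mul hplus hdvd
  · rw [← pow_mul, mul_comm, pow_mul]
    exact hq.trans (sub_one_dvd_pow_sub_one _ _)

theorem le_pow_totient_mul {N P q r m : ℕ} (hN : 2 ≤ N) (hP : P ≠ 0) (hcop : P.Coprime N)
    (hqP : q ∣ P ^ m) (hr : 0 < r) (hq : (q : ℤ) ∣ (N : ℤ) ^ r - 1) :
    q ≤ N ^ (2 * P.totient) * r := by
  have hpow : 1 < (N : ℤ) ^ (2 * P.totient) :=
    one_lt_pow₀ (by exact_mod_cast hN) (by simpa using hP)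
  have hle := Int.le_of_dvd (mul_pos (sub_pos.2 hpow) (by exact_mod_cast hr))
    (dvd_pow_totient_sub_one_mul hcop hqP hq)
  zify
  linarith

theorem dvd_pow_of_dvd_pow_of_le {P q m n : ℕ} (hq : q ≠ 0) (h : q ∣ P ^ m) (hn : q ≤ n) :
    q ∣ P ^ n := by
  refine (Nat.dvd_iff_prime_pow_dvd_dvd _ _).2 fun p j hp hpj => ?_
  rcases eq_or_ne j 0 with rfl | hj
  · simp
  have hpP : p ∣ P := hp.dvd_of_dvd_pow ((dvd_pow_self p hj).trans (hpj.trans h))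
  have hjn : j ≤ n :=
    (Nat.lt_pow_self hp.one_lt).le.trans ((Nat.le_of_dvd (Nat.pos_of_ne_zero hq) hpj).trans hn)
  exact (pow_dvd_pow_of_dvd hpP j).trans (pow_dvd_pow P hjn)

theorem exists_bound_of_le_mul_pow {N c : ℕ} (hc : c < N) (A : ℕ) :
    ∃ k₀ : ℕ, ∀ k, N ^ k ≤ A * c ^ k → k ≤ k₀ := by
  have hN : (0 : ℝ) < N := by exact_mod_cast c.zero_le.trans_lt hc
  have hlt : (c : ℝ) / N < 1 := (div_lt_one hN).2 (by exact_mod_cast hc)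
  obtain ⟨k₀, hk₀⟩ := exists_pow_lt_of_lt_one (by positivity : (0 : ℝ) < 1 / (A + 1)) hlt
  refine ⟨k₀, fun k hk => ?_⟩
  by_contra! hgt
  have hsmall : ((c : ℝ) / N) ^ k < 1 / (A + 1) :=
    (pow_le_pow_of_le_one (by positivity) hlt.le hgt.le).trans_lt hk₀
  rw [div_pow, div_lt_div_iff₀ (by positivity) (by positivity)] at hsmall
  have hk' : (N : ℝ) ^ k ≤ A * c ^ k := by exact_mod_cast hk
  linarith [pow_nonneg (c.cast_nonneg (α := ℝ)) k]

theorem addOrderOf_mk_dvd_iff {B : Finset ℤ} {x : ℝ} {n : ℕ} :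
    addOrderOf (x : ℝ ⧸ periodGroup B) ∣ n ↔ (n : ℝ) * x ∈ periodGroup B := by
  rw [addOrderOf_dvd_iff_nsmul_eq_zero, ← QuotientAddGroup.mk_nsmul, QuotientAddGroup.eq_zero_iff,
    nsmul_eq_mul]

theorem pow_mul_sub_eq_of_tau_eq {N : ℕ} (hN : (N : ℝ) ≠ 0) {a : ℕ → ℝ} {l : ℕ → ℤ}
    (hl : ∀ n, tau N (l n) (a n) = a (n + 1)) {i j k : ℕ}
    (hword : ∀ s < k, l (i + s) = l (j + s)) :
    (N : ℝ) ^ k * (a (i + k) - a (j + k)) = a i - a j := by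
  induction k with
  | zero => simp
  | succ k ih =>
    rw [← ih fun s hs => hword s (hs.trans k.lt_succ_self), pow_succ, mul_assoc, mul_sub,
      ← add_assoc, ← add_assoc, ← hl, ← hl, mul_tau hN, mul_tau hN, hword k k.lt_succ_self,
      add_sub_add_right_eq_sub]

namespace IsPeriodicPath

variable {N : ℕ} {L : Finset ℤ} {K : ℕ} {a : ℕ → ℝ}

/-- Pigeonhole on the words of length `k`: two stretches with the same word end at points less than
`1 / M` apart, hence equal. -/
theorem exists_add_eq (h : IsPeriodicPath N L K a) (hN : 2 ≤ N) {M : ℤ} (hM : M ≠ 0)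
    (hint : ∀ n, ∃ z : ℤ, M * a n = z) {k : ℕ}
    (hk : 2 * M.natAbs * L.sup Int.natAbs < N ^ k) :
    ∃ n r, 0 < r ∧ r ≤ L.card ^ k ∧ a (n + r) = a n := by
  have hN0 : (N : ℝ) ≠ 0 := by positivity
  choose l hlL hl using h.step
  obtain ⟨i, j, hne, hword⟩ := Fintype.exists_ne_map_eq_of_card_lt
    (fun (n : Fin (L.card ^ k + 1)) (s : Fin k) => (⟨l (n + s), hlL _⟩ : L)) (by simp)
  wlog hij : i < j generalizing i j
  · exact this j i hne.symm hword.symm (hne.symm.lt_of_le (not_lt.1 hij))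
  have hdist := pow_mul_sub_eq_of_tau_eq hN0 hl fun s hs =>
    congrArg Subtype.val (congrFun hword ⟨s, hs⟩)
  obtain ⟨z, hz⟩ := hint (i + k)
  obtain ⟨w, hw⟩ := hint (j + k)
  have habs : |(M : ℝ) * (a i - a j)| < (N : ℝ) ^ k := by
    have hk' : 2 * |(M : ℝ)| * (L.sup Int.natAbs : ℕ) < (N : ℝ) ^ k := by
      rw [← Int.cast_abs, Int.abs_eq_natAbs]
      exact_mod_cast hk
    rw [abs_mul]
    have := (abs_sub (a i) (a j)).trans (add_le_add (h.abs_le hN i) (h.abs_le hN j))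
    nlinarith [abs_nonneg (M : ℝ)]
  have hzw : z = w := by
    rw [← hdist, mul_left_comm, mul_sub, hz, hw, abs_mul, abs_pow, Nat.abs_cast,
      mul_lt_iff_lt_one_right (by positivity)] at habs
    exact sub_eq_zero.1 (Int.abs_lt_one_iff.1 (by exact_mod_cast habs))
  refine ⟨i + k, j - i, by omega, by omega, ?_⟩
  rw [show (i : ℕ) + k + (j - i) = j + k by omega]
  exact mul_left_cancel₀ (Int.cast_ne_zero.2 hM) (by rw [hz, hw, hzw])

theorem addOrderOf_dvd (h : IsPeriodicPath N L K a) (hN : (N : ℝ) ≠ 0) (B : Finset ℤ) {n r : ℕ}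
    (hr : a (n + r) = a n) :
    (addOrderOf (a 0 : ℝ ⧸ periodGroup B) : ℤ) ∣ (N : ℤ) ^ r - 1 := by
  have hfix := h.pow_nsmul_mk hN B n r
  rw [hr] at hfix
  have hzero := h.pow_nsmul_mk hN B 0 n
  rw [zero_add] at hzero
  rw [addOrderOf_dvd_iff_zsmul_eq_zero, ← hzero, sub_smul, one_smul, sub_eq_zero, ← Nat.cast_pow,
    natCast_zsmul, smul_comm, hfix]

theorem exists_addOrderOf_dvd (h : IsPeriodicPath N L K a) (hN : 2 ≤ N) {B : Finset ℤ} {D : ℤ}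
    (hD : D ≠ 0) (hint : ∀ x ∈ periodGroup B, ∃ n : ℤ, D * x = n)
    (hq : addOrderOf (a 0 : ℝ ⧸ periodGroup B) ≠ 0) {k : ℕ}
    (hk : 2 * (D.natAbs * addOrderOf (a 0 : ℝ ⧸ periodGroup B)) * L.sup Int.natAbs < N ^ k) :
    ∃ r, 0 < r ∧ r ≤ L.card ^ k ∧
      (addOrderOf (a 0 : ℝ ⧸ periodGroup B) : ℤ) ∣ (N : ℤ) ^ r - 1 := by
  have hN0 : (N : ℝ) ≠ 0 := by positivity
  set q := addOrderOf (a 0 : ℝ ⧸ periodGroup B)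
  have hDq (n : ℕ) : ∃ z : ℤ, ((D * q : ℤ) : ℝ) * a n = z := by
    obtain ⟨z, hz⟩ := hint _ ((h.mul q).mem_periodGroup hN0 (addOrderOf_mk_dvd_iff.1 dvd_rfl) n)
    exact ⟨z, by rw [← hz]; push_cast; ring⟩
  obtain ⟨n, r, hr0, hr, har⟩ := h.exists_add_eq hN
    (mul_ne_zero hD (Nat.cast_ne_zero.2 hq)) hDq (by rwa [Int.natAbs_mul, Int.natAbs_natCast])
  exact ⟨r, hr0, hr, h.addOrderOf_dvd hN0 B har⟩

end IsPeriodicPath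

namespace IsHadamardTriple

variable {N : ℕ} {B L : Finset ℤ}

theorem exists_addOrderOf_le (h : IsHadamardTriple N B L) (hlt : B.card < N) {P : ℕ}
    (hcop : P.Coprime N) :
    ∃ Q : ℕ, ∀ K a, IsPeriodicPath N L K a → ∀ m,
      addOrderOf (a 0 : ℝ ⧸ periodGroup B) ∣ P ^ m →
      addOrderOf (a 0 : ℝ ⧸ periodGroup B) ≤ Q := by
  have hN := h.two_le
  have hP := h.ne_zero_of_coprime hcop
  obtain ⟨D, hD, hint⟩ := exists_mul_eq_intCast_of_mem_periodGroup h.two_le_card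
  set E := 2 * D.natAbs * L.sup Int.natAbs + 1 with hE
  obtain ⟨k₀, hk₀⟩ := exists_bound_of_le_mul_pow (h.card_eq ▸ hlt)
    (N * (E * N ^ (2 * P.totient)))
  refine ⟨N ^ k₀, fun K a ha m hm => ?_⟩
  set q := addOrderOf (a 0 : ℝ ⧸ periodGroup B)
  have hq0 : 0 < q := Nat.pos_of_dvd_of_pos hm (pow_pos (Nat.pos_of_ne_zero hP) m)
  set k := Nat.log N (E * q)
  have hlower : N ^ k ≤ E * q := Nat.pow_log_le_self N (by positivity)
  have hupper : E * q < N ^ (k + 1) := Nat.lt_pow_succ_log_self hN _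
  have hlarge : 2 * (D.natAbs * q) * L.sup Int.natAbs < N ^ (k + 1) := by nlinarith
  obtain ⟨r, hr0, hr, hdvd⟩ := ha.exists_addOrderOf_dvd hN hD hint hq0.ne' hlarge
  have hqr := le_pow_totient_mul hN hP hcop hm hr0 hdvd
  have hkk₀ : k + 1 ≤ k₀ := by
    refine hk₀ _ ?_
    calc N ^ (k + 1) = N * N ^ k := pow_succ' N k
      _ ≤ N * (E * (N ^ (2 * P.totient) * L.card ^ (k + 1))) := by
        gcongr
        exact hlower.trans (Nat.mul_le_mul_left E (hqr.trans (Nat.mul_le_mul_left _ hr)))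
      _ = N * (E * N ^ (2 * P.totient)) * L.card ^ (k + 1) := by ring
  calc q ≤ E * q := Nat.le_mul_of_pos_left q (by positivity)
    _ ≤ N ^ (k + 1) := hupper.le
    _ ≤ N ^ k₀ := Nat.pow_le_pow_right (by omega) hkk₀

end IsHadamardTriple

/-- Multiplication by `t` creates no new extreme cycles: a periodic point of the dual system that
`t` maps into `B°` already lies in `B°`. For `t` coprime to `N` this characterizes the spectral
eigenvalues. -/
def IsSaturatedAt (N : ℕ) (B L : Finset ℤ) (t : ℕ) : Prop :=
  ∀ K a, IsPeriodicPath N L K a → (t : ℝ) * a 0 ∈ periodGroup B → a 0 ∈ periodGroup B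

theorem IsHadamardTriple.exists_saturated {N : ℕ} {B L : Finset ℤ} (h : IsHadamardTriple N B L)
    (hlt : B.card < N) {P : ℕ} (hcop : P.Coprime N) :
    ∃ n₀ : ℕ, ∀ n ≥ n₀, IsSaturatedAt N B L (P ^ n) →
      ∀ t m, t ∣ P ^ m → IsSaturatedAt N B L t := by
  obtain ⟨Q, hQ⟩ := h.exists_addOrderOf_le hlt hcop
  refine ⟨Q, fun n hn hsat t m htm K a ha hta => hsat K a ha (addOrderOf_mk_dvd_iff.1 ?_)⟩
  have hdvd := (addOrderOf_mk_dvd_iff.2 hta).trans htm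
  exact dvd_pow_of_dvd_pow_of_le
    (ne_zero_of_dvd_ne_zero (pow_ne_zero m (h.ne_zero_of_coprime hcop)) hdvd) hdvd
    ((hQ K a ha m hdvd).trans hn)

/-! ### Spectral eigenvalues -/

section

variable {N : ℕ} {B L : Finset ℤ}

theorem smul_canonicalSpectrum_subset (hN : (N : ℝ) ≠ 0) (h0 : 0 ∈ B) (t : ℕ) :
    (t : ℝ) • canonicalSpectrum N B L ⊆ canonicalSpectrum N B (dilate t L) := by
  refine Set.image_subset_iff.2
    (canonicalSpectrum_subset (fun C hC x hx => ?_) fun x hx l hl => ?_)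
  · obtain ⟨K, a, ha, rfl, -⟩ := hC.1.exists_path hx
    have hper : (t : ℝ) * a 0 ∈ periodGroup B := by
      simpa using nsmul_mem (mem_periodGroup_of_norm_maskFunction h0 (hC.2 _ hx)) t
    simpa using neg_mem_canonicalSpectrum
      ((ha.mul t).isExtremeCycle hN ⟨0, h0⟩ hper) ⟨0, rfl⟩
  · have hstep := mul_add_mem_canonicalSpectrum hx (mem_dilate.2 ⟨l, hl, rfl⟩)
    rw [Set.mem_preimage]
    convert hstep using 1
    simp only [smul_eq_mul]
    push_cast
    ring

theorem IsSaturatedAt.canonicalSpectrum_dilate_subset {t : ℕ} (hsat : IsSaturatedAt N B L t)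
    (hN : (N : ℝ) ≠ 0) (h0 : 0 ∈ B) (ht : t ≠ 0) :
    canonicalSpectrum N B (dilate t L) ⊆ (t : ℝ) • canonicalSpectrum N B L := by
  have ht' : (t : ℝ) ≠ 0 := by exact_mod_cast ht
  refine canonicalSpectrum_subset (fun C hC x hx => ?_) fun x hx l hl => ?_
  · obtain ⟨K, a, ha, rfl, -⟩ := hC.1.exists_path hx
    have hper : a 0 / t ∈ periodGroup B := by
      refine hsat K _ (ha.div ht) ?_
      rw [mul_div_cancel₀ _ ht']
      exact mem_periodGroup_of_norm_maskFunction h0 (hC.2 _ hx)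
    refine ⟨-(a 0 / t), neg_mem_canonicalSpectrum
      ((ha.div ht).isExtremeCycle hN ⟨0, h0⟩ hper) ⟨0, rfl⟩, ?_⟩
    simp only [smul_eq_mul]
    field_simp
  · obtain ⟨y, hy, rfl⟩ := hx
    obtain ⟨m, hm, rfl⟩ := mem_dilate.1 hl
    refine ⟨N * y + m, mul_add_mem_canonicalSpectrum hy hm, ?_⟩
    simp only [smul_eq_mul]
    push_cast
    ring

end

namespace IsHadamardTriple

variable {N : ℕ} {B L : Finset ℤ}

theorem isSpectralEigenvalue_of_isSaturatedAt (h : IsHadamardTriple N B L) (h0B : 0 ∈ B)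
    (h0L : 0 ∈ L) {t : ℕ} (ht : t.Coprime N) (hsat : IsSaturatedAt N B L t) :
    IsSpectralEigenvalue (selfSimilarMeasure N B h.nonempty) (canonicalSpectrum N B L) t := by
  rw [IsSpectralEigenvalue, (smul_canonicalSpectrum_subset h.natCast_ne_zero h0B t).antisymm
    (hsat.canonicalSpectrum_dilate_subset h.natCast_ne_zero h0B (h.ne_zero_of_coprime ht))]
  exact (h.dilate ht).isSpectralPair h0B (mem_dilate.2 ⟨0, h0L, mul_zero _⟩)

/-- A violation of saturation gives a point of the canonical spectrum of `(N, B, tL)` outside `tΛ`;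
its exponential is orthogonal to those of `tΛ`. -/
theorem isSaturatedAt_of_isSpectralEigenvalue (h : IsHadamardTriple N B L) (h0B : 0 ∈ B) {t : ℕ}
    (ht : t.Coprime N)
    (hsp : IsSpectralEigenvalue (selfSimilarMeasure N B h.nonempty) (canonicalSpectrum N B L) t) :
    IsSaturatedAt N B L t := by
  set μ := selfSimilarMeasure N B h.nonempty
  have hμ : IsSelfSimilarMeasure N B μ := isSelfSimilarMeasure_selfSimilarMeasure h.two_le B _
  have := hμ.isProbabilityMeasure
  have ht' : (t : ℝ) ≠ 0 := by exact_mod_cast h.ne_zero_of_coprime ht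
  intro K a ha hta
  have hmem : -((t : ℝ) * a 0) ∈ canonicalSpectrum N B (dilate t L) :=
    (h.dilate ht).neg_mem_canonicalSpectrum_of_path (ha.mul t) hta
  by_contra hnot
  have hnotMem : -((t : ℝ) * a 0) ∉ (t : ℝ) • canonicalSpectrum N B L := by
    rw [← mul_neg, ← smul_eq_mul, Set.smul_mem_smul_set_iff₀ ht']
    exact fun hneg => hnot (neg_mem_iff.1 (canonicalSpectrum_subset_periodGroup h0B hneg))
  obtain ⟨-, e, he⟩ := isSpectralPair_iff.1 hsp
  have hzero : expLp μ (-((t : ℝ) * a 0)) = 0 := by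
    refine (map_eq_zero_iff e.repr e.repr.injective).1 ?_
    ext l
    rw [e.repr_apply_apply, he, inner_expLp]
    exact (h.dilate ht).charFun_sub_eq_zero h0B hμ hmem
      (smul_canonicalSpectrum_subset h.natCast_ne_zero h0B t l.2) fun heq => hnotMem (heq ▸ l.2)
  have hnorm := norm_expLp (μ := μ) (-((t : ℝ) * a 0))
  rw [hzero, norm_zero] at hnorm
  exact zero_ne_one hnorm

theorem isSpectralEigenvalue_iff_isSaturatedAt (h : IsHadamardTriple N B L) (h0B : 0 ∈ B)
    (h0L : 0 ∈ L) {t : ℕ} (ht : t.Coprime N) :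
    IsSpectralEigenvalue (selfSimilarMeasure N B h.nonempty) (canonicalSpectrum N B L) t ↔
      IsSaturatedAt N B L t :=
  ⟨h.isSaturatedAt_of_isSpectralEigenvalue h0B ht,
    h.isSpectralEigenvalue_of_isSaturatedAt h0B h0L ht⟩

end IsHadamardTriple

theorem prod_pow_dvd_prod_pow_sum {ι : Type*} [Fintype ι] (p m : ι → ℕ) :
    ∏ i, p i ^ m i ∣ (∏ i, p i) ^ ∑ i, m i := by
  rw [← Finset.prod_pow]
  exact Finset.prod_dvd_prod_of_dvd _ _ fun i hi =>
    pow_dvd_pow _ (Finset.single_le_sum (fun _ _ => Nat.zero_le _) hi)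

end CanonicalSpectrum

end

theorem theorem3_general (N : ℕ) (B L : Finset ℤ)
    (hT : CanonicalSpectrum.IsHadamardTriple N B L)
    (h0B : (0 : ℤ) ∈ B) (h0L : (0 : ℤ) ∈ L) (hlt : B.card < N)
    (P : ℕ) (hcop : Nat.Coprime P N) :
    ∃ n₀ : ℕ, ∀ n ≥ n₀,
      CanonicalSpectrum.IsSpectralEigenvalue
          (CanonicalSpectrum.selfSimilarMeasure N B hT.nonempty)
          (CanonicalSpectrum.canonicalSpectrum N B L) ((P ^ n : ℕ) : ℝ) →
        ∀ t m : ℕ, t ∣ P ^ m →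
          CanonicalSpectrum.IsSpectralEigenvalue
            (CanonicalSpectrum.selfSimilarMeasure N B hT.nonempty)
            (CanonicalSpectrum.canonicalSpectrum N B L) (t : ℝ) := by
  obtain ⟨n₀, hn₀⟩ := hT.exists_saturated hlt hcop
  refine ⟨n₀, fun n hn hsp t m htm => ?_⟩
  have hsat := (hT.isSpectralEigenvalue_iff_isSaturatedAt h0B h0L (hcop.pow_left n)).1 hsp
  exact (hT.isSpectralEigenvalue_iff_isSaturatedAt h0B h0L
    (Nat.Coprime.coprime_dvd_left htm (hcop.pow_left m))).2 (hn₀ n hn hsat t m htm)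

theorem theorem3 (N : ℕ) (B L : Finset ℤ)
    (hT : CanonicalSpectrum.IsHadamardTriple N B L)
    (h0B : (0 : ℤ) ∈ B) (h0L : (0 : ℤ) ∈ L) (hlt : B.card < N)
    (k : ℕ) (p : Fin k → ℕ) (hp : ∀ i, (p i).Prime) (hinj : Function.Injective p)
    (hcop : Nat.Coprime (∏ i, p i) N) :
    ∃ n₀ : ℕ, ∀ n ≥ n₀,
      CanonicalSpectrum.IsSpectralEigenvalue
          (CanonicalSpectrum.selfSimilarMeasure N B hT.nonempty)
          (CanonicalSpectrum.canonicalSpectrum N B L)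
          ((((∏ i, p i) ^ n : ℕ)) : ℝ) →
        ∀ m : Fin k → ℕ,
          CanonicalSpectrum.IsSpectralEigenvalue
            (CanonicalSpectrum.selfSimilarMeasure N B hT.nonempty)
            (CanonicalSpectrum.canonicalSpectrum N B L)
            (((∏ i, p i ^ m i : ℕ)) : ℝ) := by
  obtain ⟨n₀, hn₀⟩ := theorem3_general N B L hT h0B h0L hlt (∏ i, p i) hcop
  exact ⟨n₀, fun n hn hsp m =>
    hn₀ n hn hsp _ _ (CanonicalSpectrum.prod_pow_dvd_prod_pow_sum p m)⟩
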